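/- Setting. For positive integers $m,k,n$ with $mk\le n$, let $\mathcal K_{k,m,n}$ be the family of all sets $K\subseteq[n]\times[n]$ of the form $K=\bigcup_{i=1}^m S_i\times T_i$ with $S_i,T_i\subseteq[n]$, $|S_i|=|T_i|=k$, and the rectangles $S_i\times T_i$ pairwise disjoint. In submatrix detection with signal strength $\lambda>0$ one observes a random $n\times n$ matrix $X$. Under $\mathcal H_0$ its entries are i.i.d. $\mathcal N(0,1)$. Under $\mathcal H_1$ a set $K$ is drawn uniformly from $\mathcal K_{k,m,n}$ and, given $K$, the entries are independent, $\mathcal N(\lambda,1)$ at the positions in $K$ and $\mathcal N(0,1)$ elsewhere. Let $L_n=d\mathbb P_{\mathcal H_1}/d\mathbb P_{\mathcal H_0}$ be the likelihood ratio, let $L_n^{\le D}$ be its orthogonal projection in $L^2(\mathbb P_{\mathcal H_0})$ onto the polynomials of degree at most $D$ in the entries of $X$, and let $\|\cdot\|_{\mathcal H_0}$ be the norm of $L^2(\mathbb P_{\mathcal H_0})$. For sequences, write $a_n\ll b_n$ if there is $\varepsilon>0$ such that $a_n\le n^{-\varepsilon}b_n$ for all large $n$. Theorem 3 (Computational lower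 bound). Let $m=m_n\ge1$, $k=k_n\ge1$ and $\lambda=\lambda_n>0$ depend on $n$, with $m_nk_n\le n$ for all $n\geq 1$. (a) Suppose that $\frac1{\sqrt k}\ll\lambda\ll\frac n{mk^2}$. If $\lambda=O(1)$, then $\|L_n^{\le D}\|_{\mathcal H_0}=O(1)$ for any $D=D_n=\Theta(\log n)$. If moreover $\lambda\ll1$, then $\|L_n^{\le D}\|_{\mathcal H_0}=O(1)$ for any $D=D_n=\Omega(\log n)$ with $D_n= n^{o(1)}$. (b) Suppose that $\lambda\gg\frac n{mk^2}$. Then $\|L_n^{\le D}\|_{\mathcal H_0}\to\infty$, that is, $\|L_n^{\le D}\|_{\mathcal H_0}=\omega(1)$, for any $D=D_n=\Omega(\log n)$. -/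

import Mathlib

open MeasureTheory ProbabilityTheory Filter Asymptotics
open scoped ENNReal

noncomputable section

namespace SubmatrixDetection

/-! ### The detection problem -/

/-- The family of all subsets of `[n] × [n]` that are a union of `m` pairwise disjoint
rectangles `S i × T i` with `|S i| = |T i| = k`. -/
def plantedSets (n k m : ℕ) : Finset (Finset (Fin n × Fin n)) := by
  classical
  exact Finset.univ.filter fun K =>
    ∃ S T : Fin m → Finset (Fin n),
      (∀ i, (S i).card = k) ∧ (∀ i, (T i).card = k) ∧
      (Pairwise fun i j => Disjoint (S i ×ˢ T i) (S j ×ˢ T j)) ∧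
      K = Finset.univ.biUnion fun i => S i ×ˢ T i

/-- The law under the null hypothesis: an `n × n` matrix with i.i.d. entries of law `Q`. -/
abbrev nullLaw (n : ℕ) (Q : Measure ℝ) : Measure (Fin n × Fin n → ℝ) :=
  Measure.pi fun _ => Q

/-- The law of the matrix given the planted set `K`: independent entries, of law `P` on `K` and
of law `Q` off `K`. -/
def conditionalLaw {n : ℕ} (P Q : Measure ℝ) (K : Finset (Fin n × Fin n)) :
    Measure (Fin n × Fin n → ℝ) :=
  Measure.pi fun e => if e ∈ K then P else Q

/-- The law under the alternative hypothesis: the planted set is uniform on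
`plantedSets n k m`. -/
def plantedLaw (n k m : ℕ) (P Q : Measure ℝ) : Measure (Fin n × Fin n → ℝ) :=
  ∑ K ∈ plantedSets n k m, ((plantedSets n k m).card : ℝ≥0∞)⁻¹ • conditionalLaw P Q K

/-- The Gaussian null distribution `N(0,1)^{⊗ n × n}`. -/
abbrev gaussNull (n : ℕ) : Measure (Fin n × Fin n → ℝ) := nullLaw n (gaussianReal 0 1)

/-- The Gaussian alternative, with entries of law `N(lam, 1)` on the planted set. -/
abbrev gaussPlanted (n k m : ℕ) (lam : ℝ) : Measure (Fin n × Fin n → ℝ) :=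
  plantedLaw n k m (gaussianReal lam 1) (gaussianReal 0 1)

/-- The likelihood ratio of the alternative with respect to the null. -/
def likelihoodRatio (n k m : ℕ) (lam : ℝ) (x : Fin n × Fin n → ℝ) : ℝ :=
  ((gaussPlanted n k m lam).rnDeriv (gaussNull n) x).toReal

/-! ### The likelihood ratio is square integrable under the null -/

lemma gaussianReal_eq_withDensity (lam : ℝ) :
    gaussianReal lam 1 = (gaussianReal 0 1).withDensity
      (fun x => ENNReal.ofReal (Real.exp (lam * x - lam ^ 2 / 2))) := by
  rw [gaussianReal_of_var_ne_zero lam one_ne_zero, gaussianReal_of_var_ne_zero 0 one_ne_zero,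
    ← withDensity_mul _ (measurable_gaussianPDF 0 1) (by fun_prop)]
  congr 1
  ext x
  simp only [Pi.mul_apply, gaussianPDF, gaussianPDFReal]
  rw [← ENNReal.ofReal_mul (by positivity), mul_assoc (√_)⁻¹, ← Real.exp_add]
  congr 3
  simp only [NNReal.coe_one]
  ring

/-- Density of the conditional law of the matrix given the planted set. -/
def condDensity {n : ℕ} (lam : ℝ) (K : Finset (Fin n × Fin n)) (x : Fin n × Fin n → ℝ) : ℝ :=
  ∏ e, if e ∈ K then Real.exp (lam * x e - lam ^ 2 / 2) else 1

lemma condDensity_nonneg {n : ℕ} (lam : ℝ) (K : Finset (Fin n × Fin n))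
    (x : Fin n × Fin n → ℝ) : 0 ≤ condDensity lam K x := by
  refine Finset.prod_nonneg fun e _ => ?_
  split_ifs <;> positivity

lemma measurable_condDensity {n : ℕ} (lam : ℝ) (K : Finset (Fin n × Fin n)) :
    Measurable (condDensity lam K) := by
  refine Finset.measurable_prod _ fun e _ => ?_
  split_ifs <;> fun_prop

lemma integrable_exp_gaussian (lam : ℝ) :
    Integrable (fun x : ℝ => Real.exp (lam * x - lam ^ 2 / 2)) (gaussianReal 0 1) := by
  have h := (integrable_exp_mul_gaussianReal (μ := 0) (v := 1) lam).mul_const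
    (Real.exp (-(lam ^ 2 / 2)))
  refine h.congr (Eventually.of_forall fun x => ?_)
  simp only
  rw [← Real.exp_add]
  congr 1

lemma conditionalLaw_eq_withDensity {n : ℕ} (lam : ℝ) (K : Finset (Fin n × Fin n)) :
    conditionalLaw (gaussianReal lam 1) (gaussianReal 0 1) K =
      (gaussNull n).withDensity (fun x => ENNReal.ofReal (condDensity lam K x)) := by
  classical
  have hprob : ∀ e : Fin n × Fin n,
      SigmaFinite (if e ∈ K then gaussianReal lam 1 else gaussianReal 0 1) := by
    intro e; split_ifs <;> infer_instance
  unfold conditionalLaw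
  refine Measure.pi_eq fun s hs => ?_
  rw [withDensity_apply _ (MeasurableSet.univ_pi hs)]
  set g : (Fin n × Fin n) → ℝ → ℝ := fun e y =>
    (s e).indicator (fun y => if e ∈ K then Real.exp (lam * y - lam ^ 2 / 2) else 1) y with hg
  have hg0 : ∀ e y, 0 ≤ g e y := by
    intro e y
    refine Set.indicator_nonneg (fun y _ => ?_) y
    split_ifs <;> positivity
  have hgi : ∀ e, Integrable (g e) (gaussianReal 0 1) := by
    intro e
    refine Integrable.indicator ?_ (hs e)
    split_ifs
    · exact integrable_exp_gaussian lam
    · exact integrable_const 1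
  have hind : ∀ x : Fin n × Fin n → ℝ,
      (Set.univ.pi s).indicator (fun x => ENNReal.ofReal (condDensity lam K x)) x =
        ENNReal.ofReal (∏ e, g e (x e)) := by
    intro x
    by_cases hx : x ∈ Set.univ.pi s
    · rw [Set.indicator_of_mem hx]
      congr 1
      refine Finset.prod_congr rfl fun e _ => ?_
      rw [hg]
      simp only
      rw [Set.indicator_of_mem (hx e (Set.mem_univ e))]
    · rw [Set.indicator_of_notMem hx]
      have : ∃ e, x e ∉ s e := by simpa [Set.mem_pi] using hx
      obtain ⟨e, he⟩ := this
      rw [Finset.prod_eq_zero (Finset.mem_univ e), ENNReal.ofReal_zero]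
      exact Set.indicator_of_notMem he _
  rw [← lintegral_indicator (MeasurableSet.univ_pi hs)]
  simp_rw [hind]
  rw [← ofReal_integral_eq_lintegral_ofReal (Integrable.fintype_prod hgi)
    (Eventually.of_forall fun x => Finset.prod_nonneg fun e _ => hg0 e _),
    integral_fintype_prod_eq_prod,
    ENNReal.ofReal_prod_of_nonneg fun e _ => integral_nonneg (hg0 e)]
  refine Finset.prod_congr rfl fun e _ => ?_
  rw [ofReal_integral_eq_lintegral_ofReal (hgi e) (Eventually.of_forall (hg0 e))]
  have h2 : ∀ y, ENNReal.ofReal (g e y) = (s e).indicator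
      (fun y => ENNReal.ofReal (if e ∈ K then Real.exp (lam * y - lam ^ 2 / 2) else 1)) y := by
    intro y
    by_cases hy : y ∈ s e <;> simp [hg, hy]
  simp_rw [h2]
  rw [lintegral_indicator (hs e)]
  by_cases he : e ∈ K
  · simp only [he, if_true]
    rw [gaussianReal_eq_withDensity lam, withDensity_apply _ (hs e)]
  · simp [he]

lemma memLp_condDensity {n : ℕ} (lam : ℝ) (K : Finset (Fin n × Fin n)) :
    MemLp (condDensity lam K) 2 (gaussNull n) := by
  rw [memLp_two_iff_integrable_sq (measurable_condDensity lam K).aestronglyMeasurable]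
  have : (fun x => condDensity lam K x ^ 2) = fun x : Fin n × Fin n → ℝ =>
      ∏ e, (fun (e : Fin n × Fin n) (y : ℝ) =>
        if e ∈ K then Real.exp ((2 * lam) * y) * Real.exp (-lam ^ 2) else 1) e (x e) := by
    ext x
    rw [condDensity, ← Finset.prod_pow]
    refine Finset.prod_congr rfl fun e _ => ?_
    simp only
    split_ifs
    · rw [← Real.exp_nat_mul, ← Real.exp_add]
      congr 1
      push_cast
      ring
    · simp
  rw [this]
  have key : ∀ e : Fin n × Fin n, Integrable ((fun (e : Fin n × Fin n) (y : ℝ) =>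
      if e ∈ K then Real.exp ((2 * lam) * y) * Real.exp (-lam ^ 2) else 1) e)
      (gaussianReal 0 1) := by
    intro e
    simp only
    split_ifs
    · exact (integrable_exp_mul_gaussianReal (2 * lam)).mul_const _
    · exact integrable_const 1
  exact Integrable.fintype_prod key

lemma gaussPlanted_eq_withDensity (n k m : ℕ) (lam : ℝ) :
    gaussPlanted n k m lam = (gaussNull n).withDensity (fun x => ENNReal.ofReal
      (((plantedSets n k m).card : ℝ)⁻¹ * ∑ K ∈ plantedSets n k m, condDensity lam K x)) := by
  classical
  unfold gaussPlanted plantedLaw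
  by_cases h0 : (plantedSets n k m).card = 0
  · rw [Finset.card_eq_zero] at h0
    simp [h0]
  have hc : ((plantedSets n k m).card : ℝ≥0∞)⁻¹ =
      ENNReal.ofReal (((plantedSets n k m).card : ℝ)⁻¹) := by
    rw [ENNReal.ofReal_inv_of_pos (by positivity), ENNReal.ofReal_natCast]
  ext s hs
  rw [withDensity_apply _ hs, Measure.finsetSum_apply, hc]
  simp_rw [Measure.smul_apply, conditionalLaw_eq_withDensity, withDensity_apply _ hs, smul_eq_mul]
  rw [← Finset.mul_sum, ← lintegral_finsetSum _
    (fun K _ => (measurable_condDensity lam K).ennreal_ofReal), ← lintegral_const_mul _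
    (Finset.measurable_sum _ fun K _ => (measurable_condDensity lam K).ennreal_ofReal)]
  refine lintegral_congr fun x => ?_
  rw [ENNReal.ofReal_mul (by positivity),
    ENNReal.ofReal_sum_of_nonneg fun K _ => condDensity_nonneg lam K x]

lemma likelihoodRatio_ae_eq (n k m : ℕ) (lam : ℝ) :
    likelihoodRatio n k m lam =ᵐ[gaussNull n] fun x =>
      ((plantedSets n k m).card : ℝ)⁻¹ * ∑ K ∈ plantedSets n k m, condDensity lam K x := by
  have hm : Measurable fun x : Fin n × Fin n → ℝ => ENNReal.ofReal
      (((plantedSets n k m).card : ℝ)⁻¹ * ∑ K ∈ plantedSets n k m, condDensity lam K x) :=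
    ((Finset.measurable_sum _ fun K _ => measurable_condDensity lam K).const_mul _).ennreal_ofReal
  have h := Measure.rnDeriv_withDensity (gaussNull n) hm
  rw [← gaussPlanted_eq_withDensity] at h
  filter_upwards [h] with x hx
  rw [likelihoodRatio, hx, ENNReal.toReal_ofReal]
  exact mul_nonneg (by positivity) (Finset.sum_nonneg fun K _ => condDensity_nonneg lam K x)

theorem memLp_likelihoodRatio (n k m : ℕ) (lam : ℝ) :
    MemLp (likelihoodRatio n k m lam) 2 (gaussNull n) := by
  rw [memLp_congr_ae (likelihoodRatio_ae_eq n k m lam)]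
  exact (memLp_finsetSum _ fun K _ => memLp_condDensity lam K).const_mul _

/-! ### The low-degree likelihood ratio -/

/-- The likelihood ratio as an element of the Hilbert space `L²` of the null distribution. -/
def likelihoodRatioLp (n k m : ℕ) (lam : ℝ) : Lp ℝ 2 (gaussNull n) :=
  (memLp_likelihoodRatio n k m lam).toLp _

/-- The linear subspace of `L²` of the null distribution that consists of the polynomials of
total degree at most `D` in the entries of the matrix (modulo almost sure equality). -/
def lowDegree (n D : ℕ) : Submodule ℝ (Lp ℝ 2 (gaussNull n)) where
  carrier := {f | ∃ p : MvPolynomial (Fin n × Fin n) ℝ, p.totalDegree ≤ D ∧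
    f =ᵐ[gaussNull n] fun x => MvPolynomial.eval x p}
  zero_mem' := ⟨0, by simp, by
    filter_upwards [Lp.coeFn_zero ℝ 2 (gaussNull n)] with x hx
    rw [map_zero]
    exact hx⟩
  add_mem' := by
    rintro f g ⟨p, hp, hfp⟩ ⟨q, hq, hgq⟩
    refine ⟨p + q, (MvPolynomial.totalDegree_add p q).trans (max_le hp hq), ?_⟩
    filter_upwards [Lp.coeFn_add f g, hfp, hgq] with x hx h1 h2
    rw [hx, Pi.add_apply, h1, h2, map_add]
  smul_mem' := by
    rintro c f ⟨p, hp, hfp⟩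
    refine ⟨c • p, (MvPolynomial.totalDegree_smul_le c p).trans hp, ?_⟩
    filter_upwards [Lp.coeFn_smul c f, hfp] with x hx h1
    rw [hx, Pi.smul_apply, h1, MvPolynomial.smul_eval, smul_eq_mul]

/-- The class, modulo null sets, of the function defined by a polynomial. -/
def polyAEEq (n : ℕ) :
    MvPolynomial (Fin n × Fin n) ℝ →ₗ[ℝ] ((Fin n × Fin n → ℝ) →ₘ[gaussNull n] ℝ) where
  toFun p := AEEqFun.mk (fun x => MvPolynomial.eval x p)
    (MvPolynomial.continuous_eval p).aestronglyMeasurable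
  map_add' p q := by
    rw [AEEqFun.mk_add_mk]
    congr 1
    ext x
    simp
  map_smul' c p := by
    rw [RingHom.id_apply, AEEqFun.smul_mk]
    congr 1
    ext x
    simp [MvPolynomial.smul_eval]

instance finiteDimensional_lowDegree (n D : ℕ) : FiniteDimensional ℝ (lowDegree n D) := by
  let W := (MvPolynomial.restrictTotalDegree (Fin n × Fin n) ℝ D).map (polyAEEq n)
  let F : lowDegree n D →ₗ[ℝ] W :=
    { toFun := fun f => ⟨((f : Lp ℝ 2 (gaussNull n)) : (Fin n × Fin n → ℝ) →ₘ[gaussNull n] ℝ), by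
        obtain ⟨p, hp, hfp⟩ := f.2
        refine ⟨p, (MvPolynomial.mem_restrictTotalDegree _ _ _).2 hp, ?_⟩
        exact AEEqFun.ext ((AEEqFun.coeFn_mk _ _).trans hfp.symm)⟩
      map_add' := fun _ _ => rfl
      map_smul' := fun _ _ => rfl }
  refine FiniteDimensional.of_injective F fun f g h => ?_
  exact Subtype.ext (Subtype.ext (congrArg (Subtype.val : W → _) h))

/-- The `D`-low-degree likelihood ratio: the orthogonal projection of the likelihood ratio onto
the polynomials of degree at most `D`. -/
def lowDegreeLR (n k m : ℕ) (lam : ℝ) (D : ℕ) : Lp ℝ 2 (gaussNull n) :=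
  (lowDegree n D).starProjection (likelihoodRatioLp n k m lam)

/-- The `L²` norm, under the null distribution, of the `D`-low-degree likelihood ratio. -/
def lowDegreeNorm (n k m : ℕ) (lam : ℝ) (D : ℕ) : ℝ := ‖lowDegreeLR n k m lam D‖

/-! ### Asymptotics -/

/-- `a n` is polynomially smaller than `b n`, that is, smaller at least by a factor `n ^ ε`, for
some fixed `ε > 0`, for all large `n`. -/
def PolyLess (a b : ℕ → ℝ) : Prop :=
  ∃ ε : ℝ, 0 < ε ∧ ∀ᶠ n : ℕ in atTop, a n ≤ (n : ℝ) ^ (-ε) * b n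

end SubmatrixDetection

end

/-!
The proof rests on an exact formula for the low-degree norm and on a bound for the probability that
given cells are planted.

*The norm.* Products of Hermite polynomials are an orthogonal basis of the polynomials in
`L²` of the null law, and the Hermite coefficients of `exp (lam * x - lam ^ 2 / 2)` are powers of
`lam`. Summing the squared coefficients with the multinomial theorem gives (`lowDegreeNorm_sq`)
`‖L^{≤D}‖² = ∑_{d ≤ D} lam ^ (2 d) / d! * E |K ∩ K'| ^ d`, for independent planted sets `K`, `K'`.
Expanding the power, `E |K ∩ K'| ^ d` is the sum over words of `d` cells of the squared probability
that all cells of the word are planted.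

*Above the threshold* the term `d = 1` and the Cauchy–Schwarz inequality already give
`‖L^{≤D}‖ ≥ lam * m k² / n` (`le_lowDegreeNorm`).

*Below the threshold* planted sets are compared with ordered families of `m` disjoint `k × k`
rectangles. For a uniform such family, moving a row of the `i`-th rectangle to a row that no
rectangle uses shows that each prescribed incidence of a row or a column with a rectangle costs
a factor `2 k / n`, whatever the others are (`card_incidentTuples_le`). In particular most families
are sparse: no row or column is used by many rectangles, and two rectangles share a small fraction
of their rows and of their columns. The union of a sparse family determines its rectangles
(`exists_eq_of_subset_rectUnion`), so a planted set comes from at most `m!` sparse families, while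
every planted set comes from at least `m!` families; hence an event has at most twice the
probability for planted sets that it has for families (`card_filter_subset_plantedSets_le`).
Cells that span `r` rows and `c` columns contain
an edge cover of these with at most `r + c` cells, and distributing the cover over the rectangles
gives a probability of at most `m ^ min r c * (2 k / n) ^ (r + c)` up to a factor
`(r + c) ^ O(r + c)` (`card_filter_subset_plantedSets_le_pow`).

There are at most `n ^ (r + c) * (r c) ^ d` words with `r` rows and `c` columns. Since
`lam * m k² ≤ n ^ (1 - ε)` and `lam` is bounded, the factor `lam ^ (2 max r c)` compensates the
powers of `n`, `m`, `k` with a surplus `n ^ (-ε (r + c))` (`weight_le`). The remaining factor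
`lam ^ (2 (d - max r c)) * (r c) ^ d / d!` is at most `n ^ (η (r + c))` for every `η > 0`, in both
ranges of the degree (`word_factor_le_of_polyLess`, `word_factor_le_of_log`). The assumption
`lam ≫ k ^ (-1 / 2)` serves only to make `k` grow polynomially and to give `m k ≤ n ^ (1 - ε)`,
which is what sparsity needs.
-/

namespace SubmatrixDetection

/-! ### Hermite polynomials and the Gaussian law -/

lemma integrable_poly_gaussianReal (μ : ℝ) (p : Polynomial ℝ) :
    Integrable (fun x => p.eval x) (gaussianReal μ 1) := by
  induction p using Polynomial.induction_on' with
  | add p q hp hq => exact (hp.add hq).congr (Eventually.of_forall fun x => by simp)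
  | monomial n a =>
    simp only [Polynomial.eval_monomial]
    refine Integrable.const_mul ?_ a
    have h := (memLp_id_gaussianReal (μ := μ) (v := 1) (n : NNReal)).integrable_norm_pow'
    refine h.mono' (by fun_prop) (Eventually.of_forall fun x => ?_)
    simp

/-- Gaussian integration by parts against a polynomial. -/
lemma integral_sub_mul_poly_gaussianReal (μ : ℝ) (p : Polynomial ℝ) :
    ∫ x, (x - μ) * p.eval x ∂gaussianReal μ 1 =
      ∫ x, p.derivative.eval x ∂gaussianReal μ 1 := by
  have hd : ∀ x, HasDerivAt (gaussianPDFReal μ 1) (-(x - μ) * gaussianPDFReal μ 1 x) x := by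
    intro x
    have h : HasDerivAt (fun y : ℝ => (√(2 * Real.pi * (1 : NNReal)))⁻¹ *
        Real.exp (-(y - μ) ^ 2 / (2 * (1 : NNReal))))
        ((√(2 * Real.pi * (1 : NNReal)))⁻¹ *
          (Real.exp (-(x - μ) ^ 2 / (2 * (1 : NNReal))) * (-(2 * (x - μ)) / 2))) x := by
      refine HasDerivAt.const_mul _ (HasDerivAt.exp ?_)
      have h1 : HasDerivAt (fun y : ℝ => y - μ) 1 x := (hasDerivAt_id x).sub_const μ
      have h2 := ((h1.pow 2).neg).div_const 2
      simpa using h2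
    refine h.congr_deriv ?_
    simp only [gaussianPDFReal]
    ring
  have key : ∀ q : Polynomial ℝ, Integrable (fun x => gaussianPDFReal μ 1 x * q.eval x) := by
    intro q
    have h := integrable_poly_gaussianReal μ q
    rw [gaussianReal_of_var_ne_zero μ one_ne_zero, integrable_withDensity_iff_integrable_smul'
      (measurable_gaussianPDF μ 1) (Eventually.of_forall fun _ => gaussianPDF_lt_top)] at h
    simpa [toReal_gaussianPDF] using h
  have hint := integral_eq_zero_of_hasDerivAt_of_integrable
    (f := fun x => gaussianPDFReal μ 1 x * p.eval x)
    (f' := fun x => -(x - μ) * gaussianPDFReal μ 1 x * p.eval x +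
      gaussianPDFReal μ 1 x * p.derivative.eval x)
    (fun x => (hd x).mul (p.hasDerivAt x)) ?_ (key p)
  · rw [integral_gaussianReal_eq_integral_smul one_ne_zero,
      integral_gaussianReal_eq_integral_smul one_ne_zero]
    rw [integral_add ?_ (key _)] at hint
    · have : (∫ x, gaussianPDFReal μ 1 x • ((x - μ) * p.eval x)) =
          -∫ x, -(x - μ) * gaussianPDFReal μ 1 x * p.eval x := by
        rw [← integral_neg]
        congr 1
        ext x
        simp only [smul_eq_mul]
        ring
      rw [this]
      simp only [smul_eq_mul]
      linarith
    · refine (key (-(Polynomial.X - Polynomial.C μ) * p)).congr (Eventually.of_forall fun x => ?_)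
      simp
      ring
  · refine Integrable.add ?_ (key _)
    refine (key (-(Polynomial.X - Polynomial.C μ) * p)).congr (Eventually.of_forall fun x => ?_)
    simp
    ring

/-- The probabilists' Hermite polynomial with real coefficients. -/
noncomputable def hermiteReal (j : ℕ) : Polynomial ℝ :=
  (Polynomial.hermite j).map (Int.castRingHom ℝ)

lemma hermiteReal_zero : hermiteReal 0 = 1 := by simp [hermiteReal]

lemma hermiteReal_succ (j : ℕ) : hermiteReal (j + 1) =
    Polynomial.X * hermiteReal j - (hermiteReal j).derivative := by
  simp [hermiteReal, Polynomial.hermite_succ, Polynomial.derivative_map]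

lemma natDegree_hermiteReal (j : ℕ) : (hermiteReal j).natDegree = j := by
  rw [hermiteReal, (Polynomial.hermite_monic j).natDegree_map, Polynomial.natDegree_hermite]

lemma coeff_hermiteReal_self (j : ℕ) : (hermiteReal j).coeff j = 1 := by
  simp [hermiteReal]

lemma integral_hermiteReal (μ : ℝ) (j : ℕ) :
    ∫ x, (hermiteReal j).eval x ∂gaussianReal μ 1 = μ ^ j := by
  induction j with
  | zero => simp [hermiteReal_zero]
  | succ j ih =>
    have h := integral_sub_mul_poly_gaussianReal μ (hermiteReal j)
    have h1 : Integrable (fun x => (x - μ) * (hermiteReal j).eval x) (gaussianReal μ 1) := by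
      exact (integrable_poly_gaussianReal μ ((Polynomial.X - Polynomial.C μ) * hermiteReal j)).congr
        (Eventually.of_forall fun x => by simp)
    have h2 : ∀ x, (hermiteReal (j + 1)).eval x = (x - μ) * (hermiteReal j).eval x +
        (μ * (hermiteReal j).eval x - (hermiteReal j).derivative.eval x) := by
      intro x
      rw [hermiteReal_succ]
      simp
      ring
    simp_rw [h2]
    have h3 := (integrable_poly_gaussianReal μ (hermiteReal j)).const_mul μ
    have h4 := integrable_poly_gaussianReal μ (hermiteReal j).derivative
    have h5 : Integrable (fun x => μ * (hermiteReal j).eval x -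
        (hermiteReal j).derivative.eval x) (gaussianReal μ 1) := h3.sub h4
    rw [integral_add h1 h5, integral_sub h3 h4, h, integral_const_mul, ih]
    ring

lemma integral_hermiteReal_mul (i : ℕ) (g : Polynomial ℝ) :
    ∫ x, (hermiteReal i).eval x * g.eval x ∂gaussianReal 0 1 =
      ∫ x, (Polynomial.derivative^[i] g).eval x ∂gaussianReal 0 1 := by
  induction i generalizing g with
  | zero => simp [hermiteReal_zero]
  | succ i ih =>
    rw [Function.iterate_succ_apply, ← ih]
    have h := integral_sub_mul_poly_gaussianReal 0 (hermiteReal i * g)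
    simp only [Polynomial.derivative_mul, Polynomial.eval_add, Polynomial.eval_mul, sub_zero] at h
    have hi : ∀ p q : Polynomial ℝ, Integrable (fun x => p.eval x * q.eval x)
        (gaussianReal 0 1) := fun p q => by
      simpa using integrable_poly_gaussianReal 0 (p * q)
    rw [integral_add (hi _ _) (hi _ _)] at h
    have h2 : ∀ x, (hermiteReal (i + 1)).eval x * g.eval x =
        x * ((hermiteReal i).eval x * g.eval x) -
          (hermiteReal i).derivative.eval x * g.eval x := by
      intro x
      rw [hermiteReal_succ]
      simp
      ring
    simp_rw [h2]
    rw [integral_sub ?_ (hi _ _), h]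
    · ring
    · exact (integrable_poly_gaussianReal 0 (Polynomial.X * (hermiteReal i * g))).congr
        (Eventually.of_forall fun x => by simp)

lemma integral_hermiteReal_mul_hermiteReal (i j : ℕ) :
    ∫ x, (hermiteReal i).eval x * (hermiteReal j).eval x ∂gaussianReal 0 1 =
      if i = j then (i.factorial : ℝ) else 0 := by
  have hlt : ∀ i j : ℕ, j < i →
      ∫ x, (hermiteReal i).eval x * (hermiteReal j).eval x ∂gaussianReal 0 1 = 0 := by
    intro i j hij
    rw [integral_hermiteReal_mul, Polynomial.iterate_derivative_eq_zero]
    · simp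
    · rwa [natDegree_hermiteReal]
  rcases lt_trichotomy i j with h | h | h
  · rw [if_neg h.ne]
    simp_rw [mul_comm (Polynomial.eval _ (hermiteReal i))]
    exact hlt j i h
  · subst h
    rw [if_pos rfl, integral_hermiteReal_mul]
    have h0 : (Polynomial.derivative^[i] (hermiteReal i)).natDegree = 0 := by
      have := Polynomial.natDegree_iterate_derivative (hermiteReal i) i
      rw [natDegree_hermiteReal] at this
      omega
    rw [Polynomial.eq_C_of_natDegree_eq_zero h0]
    simp [Polynomial.coeff_iterate_derivative, coeff_hermiteReal_self, Nat.descFactorial_self]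
  · rw [if_neg h.ne']
    exact hlt i j h

/-- The Hermite coefficients of the likelihood ratio of `N(lam, 1)` against `N(0, 1)` are the
powers of `lam`. -/
lemma integral_exp_mul_hermiteReal (lam : ℝ) (j : ℕ) :
    ∫ x, Real.exp (lam * x - lam ^ 2 / 2) * (hermiteReal j).eval x ∂gaussianReal 0 1 =
      lam ^ j := by
  rw [← integral_hermiteReal lam j, gaussianReal_eq_withDensity lam,
    integral_withDensity_eq_integral_toReal_smul (by fun_prop)
      (Eventually.of_forall fun _ => ENNReal.ofReal_lt_top)]
  simp [ENNReal.toReal_ofReal (Real.exp_nonneg _)]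

lemma derivative_hermiteReal_succ (j : ℕ) :
    (hermiteReal (j + 1)).derivative = Polynomial.C ((j : ℝ) + 1) * hermiteReal j := by
  induction j with
  | zero => simp [hermiteReal_succ, hermiteReal_zero]
  | succ j ih =>
    rw [hermiteReal_succ (j + 1), Polynomial.derivative_sub, Polynomial.derivative_mul, ih]
    simp only [Polynomial.derivative_X, Polynomial.derivative_mul, Polynomial.derivative_C]
    have h := hermiteReal_succ j
    push_cast
    simp only [map_add, map_one]
    linear_combination (-(Polynomial.C (j : ℝ)) - 1) * h

/-- The three-term recurrence; at `j = 0` the last term vanishes with its coefficient. -/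
lemma X_mul_hermiteReal (j : ℕ) : Polynomial.X * hermiteReal j =
    hermiteReal (j + 1) + Polynomial.C (j : ℝ) * hermiteReal (j - 1) := by
  rw [hermiteReal_succ]
  cases j with
  | zero => simp [hermiteReal_zero]
  | succ j =>
    rw [derivative_hermiteReal_succ]
    push_cast
    simp

/-! ### Multivariate Hermite polynomials -/

section

variable {σ : Type*} [Fintype σ]

/-- The Hermite polynomial of multi-index `α`, a product of Hermite polynomials in the
coordinates. -/
noncomputable def hermiteMv (α : σ → ℕ) : MvPolynomial σ ℝ :=
  ∏ e, Polynomial.aeval (MvPolynomial.X e) (hermiteReal (α e))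

lemma eval_hermiteMv (α : σ → ℕ) (x : σ → ℝ) :
    MvPolynomial.eval x (hermiteMv α) = ∏ e, (hermiteReal (α e)).eval (x e) := by
  rw [hermiteMv, map_prod]
  refine Finset.prod_congr rfl fun e _ => ?_
  rw [Polynomial.aeval_def, Polynomial.hom_eval₂, MvPolynomial.eval_X]
  have : (MvPolynomial.eval x).comp (algebraMap ℝ (MvPolynomial σ ℝ)) = RingHom.id ℝ := by
    ext; simp
  rw [this, Polynomial.eval₂_id]

lemma totalDegree_hermiteMv (α : σ → ℕ) : (hermiteMv α).totalDegree ≤ ∑ e, α e := by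
  refine (MvPolynomial.totalDegree_finsetProd _ _).trans (Finset.sum_le_sum fun e _ => ?_)
  rw [Polynomial.aeval_eq_sum_range, natDegree_hermiteReal]
  refine MvPolynomial.totalDegree_finsetSum_le fun i hi => ?_
  refine (MvPolynomial.totalDegree_smul_le _ _).trans ?_
  rw [MvPolynomial.totalDegree_X_pow]
  have := Finset.mem_range.1 hi
  omega

/-- The span of the Hermite polynomials of total degree at most `D`. -/
noncomputable def hermiteSpan (σ : Type*) [Fintype σ] (D : ℕ) : Submodule ℝ (MvPolynomial σ ℝ) :=
  Submodule.span ℝ (hermiteMv '' {α : σ → ℕ | ∑ e, α e ≤ D})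

lemma hermiteSpan_mono {D D' : ℕ} (h : D ≤ D') : hermiteSpan σ D ≤ hermiteSpan σ D' :=
  Submodule.span_mono (Set.image_mono fun _ hα => le_trans hα h)

lemma X_mul_mem_hermiteSpan (e : σ) {D : ℕ} {p : MvPolynomial σ ℝ} (hp : p ∈ hermiteSpan σ D) :
    MvPolynomial.X e * p ∈ hermiteSpan σ (D + 1) := by
  classical
  induction hp using Submodule.span_induction with
  | mem p hp =>
    obtain ⟨α, hα, rfl⟩ := hp
    have hα' : ∑ i, α i ≤ D := hα
    have hupd : ∀ j, hermiteMv (Function.update α e j) =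
        Polynomial.aeval (MvPolynomial.X e) (hermiteReal j) *
          ∏ i ∈ Finset.univ.erase e, Polynomial.aeval (MvPolynomial.X i) (hermiteReal (α i)) := by
      intro j
      rw [hermiteMv, ← Finset.mul_prod_erase _ _ (Finset.mem_univ e), Function.update_self]
      congr 1
      refine Finset.prod_congr rfl fun i hi => ?_
      rw [Function.update_of_ne (Finset.ne_of_mem_erase hi)]
    have hsum : ∀ j, ∑ i, Function.update α e j i = j + ∑ i ∈ Finset.univ.erase e, α i := by
      intro j
      rw [← Finset.add_sum_erase _ _ (Finset.mem_univ e), Function.update_self]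
      congr 1
      refine Finset.sum_congr rfl fun i hi => ?_
      rw [Function.update_of_ne (Finset.ne_of_mem_erase hi)]
    have hα2 : α e + ∑ i ∈ Finset.univ.erase e, α i ≤ D := by
      rwa [Finset.add_sum_erase _ _ (Finset.mem_univ e)]
    have hrec : MvPolynomial.X e * hermiteMv α = hermiteMv (Function.update α e (α e + 1)) +
        (α e : ℝ) • hermiteMv (Function.update α e (α e - 1)) := by
      have h := hupd (α e)
      rw [Function.update_eq_self] at h
      have h2 := congrArg (Polynomial.aeval (MvPolynomial.X e : MvPolynomial σ ℝ))
        (X_mul_hermiteReal (α e))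
      simp only [map_mul, map_add, Polynomial.aeval_X, Polynomial.aeval_C] at h2
      rw [h, hupd, hupd, ← mul_assoc, h2, Algebra.smul_def]
      ring
    rw [hrec]
    refine Submodule.add_mem _ (Submodule.subset_span ⟨_, ?_, rfl⟩)
      (Submodule.smul_mem _ _ (Submodule.subset_span ⟨_, ?_, rfl⟩))
    · show ∑ i, _ ≤ D + 1
      rw [hsum]
      omega
    · show ∑ i, _ ≤ D + 1
      rw [hsum]
      omega
  | zero => simp
  | add p q _ _ hp hq => rw [mul_add]; exact Submodule.add_mem _ hp hq
  | smul c p _ hp => rw [mul_smul_comm]; exact Submodule.smul_mem _ _ hp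

lemma X_pow_mul_mem_hermiteSpan (e : σ) (j : ℕ) {D : ℕ} {p : MvPolynomial σ ℝ}
    (hp : p ∈ hermiteSpan σ D) : MvPolynomial.X e ^ j * p ∈ hermiteSpan σ (D + j) := by
  induction j with
  | zero => simpa using hp
  | succ j ih =>
    rw [pow_succ', mul_assoc]
    exact X_mul_mem_hermiteSpan e ih

lemma mem_hermiteSpan_of_totalDegree_le {D : ℕ} {p : MvPolynomial σ ℝ} (hp : p.totalDegree ≤ D) :
    p ∈ hermiteSpan σ D := by
  classical
  have hmon : ∀ (s : σ → ℕ) (t : Finset σ),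
      (∏ e ∈ t, MvPolynomial.X e ^ s e : MvPolynomial σ ℝ) ∈ hermiteSpan σ (∑ e ∈ t, s e) := by
    intro s t
    induction t using Finset.induction_on with
    | empty =>
      refine Submodule.subset_span ⟨0, by simp, ?_⟩
      simp [hermiteMv, hermiteReal_zero]
    | insert e t he ih =>
      rw [Finset.prod_insert he, Finset.sum_insert he, add_comm (s e)]
      exact X_pow_mul_mem_hermiteSpan e (s e) ih
  rw [p.as_sum]
  refine Submodule.sum_mem _ fun s hs => ?_
  have h1 : MvPolynomial.monomial s (p.coeff s) = (p.coeff s) •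
      (∏ e, MvPolynomial.X e ^ s e : MvPolynomial σ ℝ) := by
    rw [MvPolynomial.monomial_eq, MvPolynomial.smul_eq_C_mul, Finsupp.prod_fintype _ _ (by simp)]
  rw [h1]
  refine Submodule.smul_mem _ _ (hermiteSpan_mono ?_ (hmon s _))
  refine le_trans ?_ ((MvPolynomial.le_totalDegree hs).trans hp)
  rw [Finsupp.sum_fintype _ _ (by simp)]

lemma integrable_mvPolynomial (p : MvPolynomial σ ℝ) :
    Integrable (fun x => MvPolynomial.eval x p) (Measure.pi fun _ : σ => gaussianReal 0 1) := by
  induction p using MvPolynomial.induction_on' with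
  | monomial s a =>
    simp only [MvPolynomial.eval_monomial]
    refine Integrable.const_mul ?_ a
    have h : ∀ e : σ, Integrable (fun y : ℝ => y ^ s e) (gaussianReal 0 1) := fun e =>
      (integrable_poly_gaussianReal 0 (Polynomial.X ^ s e)).congr
        (Eventually.of_forall fun x => by simp)
    refine (Integrable.fintype_prod h).congr (Eventually.of_forall fun x => ?_)
    simp [Finsupp.prod_fintype]
  | add p q hp hq => exact (hp.add hq).congr (Eventually.of_forall fun x => by simp)

lemma memLp_mvPolynomial (p : MvPolynomial σ ℝ) :
    MemLp (fun x => MvPolynomial.eval x p) 2 (Measure.pi fun _ : σ => gaussianReal 0 1) := by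
  rw [memLp_two_iff_integrable_sq (MvPolynomial.continuous_eval p).aestronglyMeasurable]
  exact (integrable_mvPolynomial (p ^ 2)).congr (Eventually.of_forall fun x => by simp)

lemma integral_hermiteMv_mul_hermiteMv (α β : σ → ℕ) :
    ∫ x, MvPolynomial.eval x (hermiteMv α) * MvPolynomial.eval x (hermiteMv β)
      ∂(Measure.pi fun _ : σ => gaussianReal 0 1) =
      if α = β then ∏ e, ((α e).factorial : ℝ) else 0 := by
  simp_rw [eval_hermiteMv, ← Finset.prod_mul_distrib]
  rw [integral_fintype_prod_eq_prod
    (f := fun e y => (hermiteReal (α e)).eval y * (hermiteReal (β e)).eval y)]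
  simp_rw [integral_hermiteReal_mul_hermiteReal]
  split_ifs with h
  · subst h; simp
  · obtain ⟨e, he⟩ := Function.ne_iff.1 h
    exact Finset.prod_eq_zero (Finset.mem_univ e) (if_neg he)

end

lemma integral_hermiteMv_mul_condDensity {n : ℕ} (lam : ℝ) (K : Finset (Fin n × Fin n))
    (α : Fin n × Fin n → ℕ) :
    ∫ x, MvPolynomial.eval x (hermiteMv α) * condDensity lam K x ∂gaussNull n =
      lam ^ (∑ e, α e) * ∏ e, (if e ∈ K then (1 : ℝ) else 0) ^ α e := by
  simp_rw [eval_hermiteMv, condDensity, ← Finset.prod_mul_distrib]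
  rw [integral_fintype_prod_eq_prod (f := fun e y => (hermiteReal (α e)).eval y *
    if e ∈ K then Real.exp (lam * y - lam ^ 2 / 2) else 1), ← Finset.prod_pow_eq_pow_sum,
    ← Finset.prod_mul_distrib]
  refine Finset.prod_congr rfl fun e _ => ?_
  split_ifs
  · simp_rw [mul_comm (Polynomial.eval _ _)]
    rw [integral_exp_mul_hermiteReal]
    simp
  · simp only [mul_one, integral_hermiteReal, ← mul_pow, mul_zero]

/-! ### The norm of the low-degree likelihood ratio -/

lemma norm_sq_starProjection_of_orthogonal {E ι : Type*} [NormedAddCommGroup E]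
    [InnerProductSpace ℝ E] [DecidableEq ι] (V : Submodule ℝ E) [V.HasOrthogonalProjection]
    (s : Finset ι) (H : ι → E) (w : ι → ℝ) (hw : ∀ i, 0 < w i)
    (hH : ∀ i j, inner ℝ (H i) (H j) = if i = j then w i else 0)
    (hmem : ∀ i ∈ s, H i ∈ V) (hspan : V ≤ Submodule.span ℝ (H '' s)) (f : E) :
    ‖V.starProjection f‖ ^ 2 = ∑ i ∈ s, inner ℝ (H i) f ^ 2 / w i := by
  set u : E := ∑ i ∈ s, (inner ℝ (H i) f / w i) • H i with hu
  have hinner : ∀ i ∈ s, inner ℝ (H i) u = inner ℝ (H i) f := by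
    intro i hi
    simp_rw [hu, inner_sum, inner_smul_right, hH]
    simp [hi, (hw i).ne']
  have hproj : V.starProjection f = u := by
    refine Submodule.eq_starProjection_of_mem_of_inner_eq_zero
      (Submodule.sum_mem _ fun i hi => Submodule.smul_mem _ _ (hmem i hi)) fun v hv => ?_
    have key : ∀ v ∈ Submodule.span ℝ (H '' s), inner ℝ (f - u) v = 0 := by
      intro v hv
      induction hv using Submodule.span_induction with
      | mem v hv =>
        obtain ⟨i, hi, rfl⟩ := hv
        rw [real_inner_comm, inner_sub_right, hinner i hi, sub_self]
      | zero => simp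
      | add v v' _ _ ih1 ih2 => rw [inner_add_right, ih1, ih2, add_zero]
      | smul c v _ ih => rw [real_inner_smul_right, ih, mul_zero]
    exact key v (hspan hv)
  rw [hproj, ← real_inner_self_eq_norm_sq]
  nth_rewrite 1 [hu]
  rw [sum_inner]
  refine Finset.sum_congr rfl fun i hi => ?_
  rw [real_inner_smul_left, hinner i hi]
  ring

/-- The linear map that sends a polynomial in the entries to its class in `L²` of the null
law. -/
noncomputable def polyLp (n : ℕ) :
    MvPolynomial (Fin n × Fin n) ℝ →ₗ[ℝ] Lp ℝ 2 (gaussNull n) where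
  toFun p := (memLp_mvPolynomial p).toLp _
  map_add' p q := by
    refine Lp.ext ?_
    filter_upwards [(memLp_mvPolynomial p).coeFn_toLp, (memLp_mvPolynomial q).coeFn_toLp,
      (memLp_mvPolynomial (p + q)).coeFn_toLp, Lp.coeFn_add ((memLp_mvPolynomial p).toLp _)
      ((memLp_mvPolynomial q).toLp _)] with x h1 h2 h3 h4
    rw [h4, h3, Pi.add_apply, h1, h2, map_add]
  map_smul' c p := by
    refine Lp.ext ?_
    filter_upwards [(memLp_mvPolynomial p).coeFn_toLp, (memLp_mvPolynomial (c • p)).coeFn_toLp,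
      Lp.coeFn_smul c ((memLp_mvPolynomial p).toLp _)] with x h1 h3 h4
    rw [RingHom.id_apply, h4, h3, Pi.smul_apply, h1, MvPolynomial.smul_eval, smul_eq_mul]

/-- The class in `L²` of the null law of a multivariate Hermite polynomial. -/
noncomputable def hermiteLp {n : ℕ} (α : Fin n × Fin n → ℕ) : Lp ℝ 2 (gaussNull n) :=
  polyLp n (hermiteMv α)

lemma hermiteLp_eq_toLp {n : ℕ} (α : Fin n × Fin n → ℕ) :
    hermiteLp α = (memLp_mvPolynomial (hermiteMv α)).toLp _ := rfl

lemma inner_toLp_toLp {Ω : Type*} {mΩ : MeasurableSpace Ω} {μ : Measure Ω} {f g : Ω → ℝ}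
    (hf : MemLp f 2 μ) (hg : MemLp g 2 μ) :
    inner ℝ (hf.toLp f) (hg.toLp g) = ∫ x, f x * g x ∂μ := by
  rw [L2.inner_def]
  refine integral_congr_ae ?_
  filter_upwards [hf.coeFn_toLp, hg.coeFn_toLp] with x h1 h2
  rw [h1, h2]
  simp [mul_comm]

lemma inner_hermiteLp_hermiteLp {n : ℕ} (α β : Fin n × Fin n → ℕ) :
    inner ℝ (hermiteLp α) (hermiteLp β) = if α = β then ∏ e, ((α e).factorial : ℝ) else 0 := by
  rw [hermiteLp_eq_toLp, hermiteLp_eq_toLp, inner_toLp_toLp, integral_hermiteMv_mul_hermiteMv]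

lemma inner_hermiteLp_likelihoodRatioLp (n k m : ℕ) (lam : ℝ) (α : Fin n × Fin n → ℕ) :
    inner ℝ (hermiteLp α) (likelihoodRatioLp n k m lam) =
      ((plantedSets n k m).card : ℝ)⁻¹ * (lam ^ (∑ e, α e) *
        ∑ K ∈ plantedSets n k m, ∏ e, (if e ∈ K then (1 : ℝ) else 0) ^ α e) := by
  rw [hermiteLp_eq_toLp, likelihoodRatioLp, inner_toLp_toLp]
  have h : ∫ x, MvPolynomial.eval x (hermiteMv α) * likelihoodRatio n k m lam x ∂gaussNull n =
      ∫ x, ((plantedSets n k m).card : ℝ)⁻¹ * ∑ K ∈ plantedSets n k m,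
        MvPolynomial.eval x (hermiteMv α) * condDensity lam K x ∂gaussNull n := by
    refine integral_congr_ae ?_
    filter_upwards [likelihoodRatio_ae_eq n k m lam] with x hx
    rw [hx, Finset.mul_sum, Finset.mul_sum, Finset.mul_sum]
    refine Finset.sum_congr rfl fun K _ => ?_
    ring
  have hint : ∀ K : Finset (Fin n × Fin n), Integrable (fun x =>
      MvPolynomial.eval x (hermiteMv α) * condDensity lam K x) (gaussNull n) := fun K =>
    (memLp_mvPolynomial (hermiteMv α)).integrable_mul (memLp_condDensity lam K)
  rw [h, integral_const_mul, integral_finsetSum _ fun K _ => hint K]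
  simp_rw [integral_hermiteMv_mul_condDensity]
  rw [Finset.mul_sum _ _ (lam ^ _)]

lemma hermiteLp_mem_lowDegree {n D : ℕ} {α : Fin n × Fin n → ℕ} (h : ∑ e, α e ≤ D) :
    hermiteLp α ∈ lowDegree n D :=
  ⟨hermiteMv α, (totalDegree_hermiteMv α).trans h,
    (memLp_mvPolynomial (hermiteMv α)).coeFn_toLp⟩

lemma lowDegree_le_span (n D : ℕ) :
    lowDegree n D ≤ Submodule.span ℝ (hermiteLp '' {α : Fin n × Fin n → ℕ | ∑ e, α e ≤ D}) := by
  rintro f ⟨p, hp, hfp⟩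
  have hf : f = polyLp n p := Lp.ext (hfp.trans (memLp_mvPolynomial p).coeFn_toLp.symm)
  have h := Submodule.mem_map_of_mem (f := polyLp n) (mem_hermiteSpan_of_totalDegree_le hp)
  rwa [hermiteSpan, Submodule.map_span, ← Set.image_comp, ← hf] at h

/-- The multi-index sum over Hermite coefficients of a fixed degree `d`, resummed by the
multinomial theorem. -/
lemma sum_piAntidiag_sq_div_factorial (n : ℕ) (F : Finset (Finset (Fin n × Fin n))) (d : ℕ) :
    ∑ α ∈ Finset.piAntidiag (Finset.univ : Finset (Fin n × Fin n)) d,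
      (∑ K ∈ F, ∏ e, (if e ∈ K then (1 : ℝ) else 0) ^ α e) ^ 2 / ∏ e, ((α e).factorial : ℝ) =
      (d.factorial : ℝ)⁻¹ * ∑ K ∈ F, ∑ K' ∈ F, ((K ∩ K').card : ℝ) ^ d := by
  classical
  have hcard : ∀ K K' : Finset (Fin n × Fin n), ((K ∩ K').card : ℝ) =
      ∑ e, (if e ∈ K then (1 : ℝ) else 0) * (if e ∈ K' then (1 : ℝ) else 0) := by
    intro K K'
    simp_rw [mul_ite, mul_one, mul_zero, ← ite_and]
    rw [Finset.sum_boole]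
    congr 2
    ext e
    simp [and_comm]
  have hpow : ∀ K K' : Finset (Fin n × Fin n), ((K ∩ K').card : ℝ) ^ d =
      ∑ α ∈ Finset.piAntidiag (Finset.univ : Finset (Fin n × Fin n)) d,
        (Nat.multinomial Finset.univ α : ℝ) * ((∏ e, (if e ∈ K then (1 : ℝ) else 0) ^ α e) *
          ∏ e, (if e ∈ K' then (1 : ℝ) else 0) ^ α e) := by
    intro K K'
    rw [hcard, Finset.sum_pow_eq_sum_piAntidiag]
    simp_rw [mul_pow, Finset.prod_mul_distrib]
  simp_rw [hpow]
  have hm : ∀ α ∈ Finset.piAntidiag (Finset.univ : Finset (Fin n × Fin n)) d,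
      (∏ e, ((α e).factorial : ℝ))⁻¹ = (d.factorial : ℝ)⁻¹ * (Nat.multinomial Finset.univ α) := by
    intro α hα
    have h := Nat.multinomial_spec Finset.univ α
    rw [(Finset.mem_piAntidiag.1 hα).1] at h
    have h' : (∏ e, ((α e).factorial : ℝ)) * (Nat.multinomial Finset.univ α : ℝ) =
        (d.factorial : ℝ) := by exact_mod_cast h
    have hp : (∏ e, ((α e).factorial : ℝ)) ≠ 0 :=
      Finset.prod_ne_zero_iff.2 fun e _ => by positivity
    have hd : (d.factorial : ℝ) ≠ 0 := by positivity
    field_simp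
    linarith
  simp_rw [Finset.sum_comm (s := F) (t := Finset.piAntidiag _ _)]
  rw [Finset.mul_sum]
  refine Finset.sum_congr rfl fun α hα => ?_
  rw [div_eq_mul_inv, hm α hα, sq, Finset.sum_mul_sum]
  simp_rw [Finset.mul_sum, Finset.sum_mul]
  refine Finset.sum_congr rfl fun K _ => Finset.sum_congr rfl fun K' _ => ?_
  ring

/-- The squared norm of the low-degree likelihood ratio is the truncated exponential moment of
the overlap of two independent planted sets. -/
theorem lowDegreeNorm_sq (n k m : ℕ) (lam : ℝ) (D : ℕ) :
    lowDegreeNorm n k m lam D ^ 2 = ∑ d ∈ Finset.range (D + 1), (lam ^ 2) ^ d / d.factorial *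
      (((plantedSets n k m).card : ℝ)⁻¹ ^ 2 *
        ∑ K ∈ plantedSets n k m, ∑ K' ∈ plantedSets n k m, ((K ∩ K').card : ℝ) ^ d) := by
  classical
  set I : Finset (Fin n × Fin n → ℕ) := (Finset.range (D + 1)).biUnion
    fun d => Finset.piAntidiag Finset.univ d with hI
  have hmem : ∀ α, α ∈ I ↔ ∑ e, α e ≤ D := by
    intro α
    simp [hI]
  have hIset : (I : Set (Fin n × Fin n → ℕ)) = {α | ∑ e, α e ≤ D} := by
    ext α
    simpa using hmem α
  rw [lowDegreeNorm, lowDegreeLR, norm_sq_starProjection_of_orthogonal _ I hermiteLp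
    (fun α => ∏ e, ((α e).factorial : ℝ)) (fun α => Finset.prod_pos fun e _ => by positivity)
    inner_hermiteLp_hermiteLp (fun α hα => hermiteLp_mem_lowDegree ((hmem α).1 hα))
    (by rw [hIset]; exact lowDegree_le_span n D), hI, Finset.sum_biUnion]
  · refine Finset.sum_congr rfl fun d _ => ?_
    have h := sum_piAntidiag_sq_div_factorial n (plantedSets n k m) d
    have h' : ∀ a b c : ℝ, a / d.factorial * (b * c) = a * b * ((d.factorial : ℝ)⁻¹ * c) :=
      fun a b c => by ring
    rw [h', ← h, Finset.mul_sum]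
    refine Finset.sum_congr rfl fun α hα => ?_
    rw [inner_hermiteLp_likelihoodRatioLp, (Finset.mem_piAntidiag.1 hα).1]
    ring
  · intro d _ d' _ hdd
    refine Finset.disjoint_left.2 fun α h1 h2 => hdd ?_
    rw [← (Finset.mem_piAntidiag.1 h1).1, ← (Finset.mem_piAntidiag.1 h2).1]

section

/-! ### Ordered families of disjoint rectangles -/

/-- The ordered families of row sets and column sets that define `m` pairwise disjoint
`k × k` rectangles. -/
noncomputable def rectTuples (n k m : ℕ) :
    Finset ((Fin m → Finset (Fin n)) × (Fin m → Finset (Fin n))) := by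
  classical
  exact Finset.univ.filter fun τ =>
    (∀ i, (τ.1 i).card = k) ∧ (∀ i, (τ.2 i).card = k) ∧
      ∀ i j, i ≠ j → Disjoint (τ.1 i) (τ.1 j) ∨ Disjoint (τ.2 i) (τ.2 j)

/-- The union of the rectangles of a family. -/
def rectUnion {n m : ℕ} (τ : (Fin m → Finset (Fin n)) × (Fin m → Finset (Fin n))) :
    Finset (Fin n × Fin n) :=
  Finset.univ.biUnion fun i => τ.1 i ×ˢ τ.2 i

/-- The families in `rectTuples n k m` that contain prescribed incidences: `(x, i) ∈ Q` asks for
the row `x` in the `i`-th row set, and `(y, i) ∈ R` for the column `y` in the `i`-th column set. -/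
noncomputable def incidentTuples (n k m : ℕ) (Q R : Finset (Fin n × Fin m)) :
    Finset ((Fin m → Finset (Fin n)) × (Fin m → Finset (Fin n))) := by
  classical
  exact (rectTuples n k m).filter fun τ =>
    (∀ e ∈ Q, e.1 ∈ τ.1 e.2) ∧ ∀ e ∈ R, e.1 ∈ τ.2 e.2

variable {n k m : ℕ}

lemma mem_rectTuples {τ : (Fin m → Finset (Fin n)) × (Fin m → Finset (Fin n))} :
    τ ∈ rectTuples n k m ↔ (∀ i, (τ.1 i).card = k) ∧ (∀ i, (τ.2 i).card = k) ∧
      ∀ i j, i ≠ j → Disjoint (τ.1 i) (τ.1 j) ∨ Disjoint (τ.2 i) (τ.2 j) := by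
  simp [rectTuples]

lemma mem_incidentTuples {Q R : Finset (Fin n × Fin m)}
    {τ : (Fin m → Finset (Fin n)) × (Fin m → Finset (Fin n))} :
    τ ∈ incidentTuples n k m Q R ↔ τ ∈ rectTuples n k m ∧
      (∀ e ∈ Q, e.1 ∈ τ.1 e.2) ∧ ∀ e ∈ R, e.1 ∈ τ.2 e.2 := by
  simp [incidentTuples]

lemma mem_rectUnion {τ : (Fin m → Finset (Fin n)) × (Fin m → Finset (Fin n))}
    {e : Fin n × Fin n} : e ∈ rectUnion τ ↔ ∃ i, e.1 ∈ τ.1 i ∧ e.2 ∈ τ.2 i := by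
  simp [rectUnion]

lemma swap_mem_rectTuples {τ : (Fin m → Finset (Fin n)) × (Fin m → Finset (Fin n))}
    (h : τ ∈ rectTuples n k m) : τ.swap ∈ rectTuples n k m := by
  rw [mem_rectTuples] at h ⊢
  exact ⟨h.2.1, h.1, fun i j hij => (h.2.2 i j hij).symm⟩

lemma mem_plantedSets {K : Finset (Fin n × Fin n)} :
    K ∈ plantedSets n k m ↔ ∃ τ ∈ rectTuples n k m, rectUnion τ = K := by
  simp only [plantedSets, Finset.mem_filter, Finset.mem_univ, true_and, Prod.exists,
    mem_rectTuples, Finset.disjoint_product, Pairwise, rectUnion]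
  constructor
  · rintro ⟨S, T, hS, hT, hd, rfl⟩
    exact ⟨S, T, ⟨hS, hT, fun i j hij => hd hij⟩, rfl⟩
  · rintro ⟨S, T, ⟨hS, hT, hd⟩, rfl⟩
    exact ⟨S, T, hS, hT, fun i j hij => hd i j hij, rfl⟩

/-! ### Switching -/

lemma card_incidentTuples_swap (Q R : Finset (Fin n × Fin m)) :
    (incidentTuples n k m Q R).card ≤ (incidentTuples n k m R Q).card := by
  refine Finset.card_le_card_of_injOn Prod.swap (fun τ hτ => ?_) Prod.swap_injective.injOn
  rw [Finset.mem_coe, mem_incidentTuples] at hτ ⊢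
  exact ⟨swap_mem_rectTuples hτ.1, hτ.2.2, hτ.2.1⟩

/-- Replacing the row `x` of the `i`-th row set by a row that lies in no row set keeps the
rectangles disjoint. There are at least `n - m k` such rows, and the replacement is undone by
naming the new row, one of the `k` elements of the new row set. -/
lemma card_incidentTuples_insert_mul_le (Q R : Finset (Fin n × Fin m)) (x : Fin n) (i : Fin m)
    (hx : (x, i) ∉ Q) : (incidentTuples n k m (insert (x, i) Q) R).card * (n - m * k) ≤
      (incidentTuples n k m Q R).card * k := by
  classical
  set A := incidentTuples n k m (insert (x, i) Q) R
  set B := incidentTuples n k m Q R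
  set P := A.sigma fun τ => (Finset.univ.biUnion τ.1)ᶜ with hP
  set P' := B.sigma fun τ => τ.1 i with hP'
  have h1 : A.card * (n - m * k) ≤ P.card := by
    rw [hP, Finset.card_sigma, ← smul_eq_mul, ← Finset.sum_const]
    refine Finset.sum_le_sum fun τ hτ => ?_
    rw [Finset.card_compl, Fintype.card_fin]
    refine Nat.sub_le_sub_left ?_ n
    refine Finset.card_biUnion_le.trans ?_
    have := (mem_rectTuples.1 (mem_incidentTuples.1 hτ).1).1
    simp [this]
  have h2 : P'.card = B.card * k := by
    rw [hP', Finset.card_sigma, ← smul_eq_mul, ← Finset.sum_const]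
    exact Finset.sum_congr rfl fun τ hτ => (mem_rectTuples.1 (mem_incidentTuples.1 hτ).1).1 i
  refine h1.trans (le_of_le_of_eq ?_ h2)
  refine Finset.card_le_card_of_injOn
    (fun p => ⟨(Function.update p.1.1 i (insert p.2 ((p.1.1 i).erase x)), p.1.2), p.2⟩) ?_ ?_
  · rintro ⟨τ, y⟩ hp
    rw [Finset.mem_coe, hP, Finset.mem_sigma, mem_incidentTuples, mem_rectTuples] at hp
    obtain ⟨⟨⟨hS, hT, hd⟩, hQ, hR⟩, hy⟩ := hp
    have hy' : ∀ j, y ∉ τ.1 j := by simpa using hy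
    have hxi : x ∈ τ.1 i := hQ (x, i) (Finset.mem_insert_self _ _)
    have hyi : y ∉ (τ.1 i).erase x := fun h => hy' i (Finset.mem_of_mem_erase h)
    rw [Finset.mem_coe, hP', Finset.mem_sigma, mem_incidentTuples, mem_rectTuples]
    have hdis : ∀ j, Disjoint (τ.1 i) (τ.1 j) →
        Disjoint (insert y ((τ.1 i).erase x)) (τ.1 j) := fun j hj => by
      rw [Finset.disjoint_insert_left]
      exact ⟨hy' j, hj.mono_left (Finset.erase_subset _ _)⟩
    refine ⟨⟨⟨fun j => ?_, hT, fun a b hab => ?_⟩, fun e he => ?_, hR⟩, ?_⟩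
    · by_cases hj : j = i
      · subst hj
        simp only [Function.update_self]
        rw [Finset.card_insert_of_notMem hyi, Finset.card_erase_add_one hxi, hS]
      · simp only [Function.update_of_ne hj, hS]
    · refine (hd a b hab).imp_left fun h => ?_
      simp only
      by_cases ha : a = i
      · subst ha
        rw [Function.update_self, Function.update_of_ne hab.symm]
        exact hdis b h
      · by_cases hb : b = i
        · subst hb
          rw [Function.update_self, Function.update_of_ne ha]
          exact (hdis a h.symm).symm
        · rwa [Function.update_of_ne ha, Function.update_of_ne hb]
    · have h := hQ e (Finset.mem_insert_of_mem he)
      simp only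
      by_cases hj : e.2 = i
      · rw [hj, Function.update_self]
        rw [hj] at h
        refine Finset.mem_insert_of_mem (Finset.mem_erase.2 ⟨fun hex => hx ?_, h⟩)
        rwa [← hex, ← hj]
      · rwa [Function.update_of_ne hj]
    · simp
  · rintro ⟨τ, y⟩ hp ⟨τ', y'⟩ hp' heq
    rw [Finset.mem_coe, hP, Finset.mem_sigma, mem_incidentTuples, mem_rectTuples] at hp hp'
    obtain ⟨⟨-, hQ, -⟩, hy⟩ := hp
    obtain ⟨⟨-, hQ', -⟩, hy'⟩ := hp'
    simp only [Sigma.mk.injEq, Prod.mk.injEq, heq_eq_eq] at heq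
    obtain ⟨⟨h1, h2⟩, rfl⟩ := heq
    have hxi : x ∈ τ.1 i := hQ (x, i) (Finset.mem_insert_self _ _)
    have hxi' : x ∈ τ'.1 i := hQ' (x, i) (Finset.mem_insert_self _ _)
    have hyi : y ∉ (τ.1 i).erase x := fun h => by
      have : ∀ j, y ∉ τ.1 j := by simpa using hy
      exact this i (Finset.mem_of_mem_erase h)
    have hyi' : y ∉ (τ'.1 i).erase x := fun h => by
      have : ∀ j, y ∉ τ'.1 j := by simpa using hy'
      exact this i (Finset.mem_of_mem_erase h)
    have h3 : τ.1 = τ'.1 := by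
      funext j
      have hj := congrFun h1 j
      by_cases hji : j = i
      · subst hji
        rw [Function.update_self, Function.update_self] at hj
        rw [← Finset.insert_erase hxi, ← Finset.insert_erase hxi', ← Finset.erase_insert hyi, hj,
          Finset.erase_insert hyi']
      · rwa [Function.update_of_ne hji, Function.update_of_ne hji] at hj
    simp [Prod.ext h3 h2]

/-- Iterated switching: incidences of a uniform family of disjoint rectangles are at most as likely
as independent events of probability `2 k / n`. -/
lemma card_incidentTuples_le (hn : 0 < n) (hmk : 2 * (m * k) ≤ n) (Q R : Finset (Fin n × Fin m)) :
    ((incidentTuples n k m Q R).card : ℝ) ≤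
      (2 * k / n : ℝ) ^ (Q.card + R.card) * (rectTuples n k m).card := by
  classical
  have hstep : ∀ (Q R : Finset (Fin n × Fin m)) (e : Fin n × Fin m), e ∉ Q →
      ((incidentTuples n k m (insert e Q) R).card : ℝ) ≤
        (2 * k / n : ℝ) * (incidentTuples n k m Q R).card := by
    intro Q R e he
    have h := card_incidentTuples_insert_mul_le (k := k) Q R e.1 e.2 he
    have h' : ((incidentTuples n k m (insert e Q) R).card : ℝ) * (n - m * k : ℕ) ≤
      (incidentTuples n k m Q R).card * k := by exact_mod_cast h
    have h2 : (n : ℝ) / 2 ≤ (n - m * k : ℕ) := by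
      rw [Nat.cast_sub (by omega)]
      have : (2 * (m * k : ℕ) : ℝ) ≤ n := by exact_mod_cast hmk
      linarith
    have h3 := (mul_le_mul_of_nonneg_left h2 (Nat.cast_nonneg
      (incidentTuples n k m (insert e Q) R).card)).trans h'
    have hn' : (0 : ℝ) < n := by exact_mod_cast hn
    rw [div_mul_eq_mul_div, le_div_iff₀ hn']
    linarith
  have hq : (0 : ℝ) ≤ 2 * k / n := by positivity
  have hR : ((incidentTuples n k m ∅ R).card : ℝ) ≤
      (2 * k / n : ℝ) ^ R.card * (rectTuples n k m).card := by
    induction R using Finset.induction_on with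
    | empty =>
      rw [Finset.card_empty, pow_zero, one_mul, Nat.cast_le]
      exact Finset.card_le_card fun τ hτ => (mem_incidentTuples.1 hτ).1
    | insert e R he ih =>
      have h1 : ((incidentTuples n k m ∅ (insert e R)).card : ℝ) ≤
          (incidentTuples n k m (insert e R) ∅).card := by
        exact_mod_cast card_incidentTuples_swap _ _
      have h2 : ((incidentTuples n k m R ∅).card : ℝ) ≤ (incidentTuples n k m ∅ R).card := by
        exact_mod_cast card_incidentTuples_swap _ _
      rw [Finset.card_insert_of_notMem he, pow_succ', mul_assoc]
      exact h1.trans ((hstep _ _ _ he).trans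
        (mul_le_mul_of_nonneg_left (h2.trans ih) hq))
  induction Q using Finset.induction_on with
  | empty => simpa using hR
  | insert e Q he ih =>
    rw [Finset.card_insert_of_notMem he, add_right_comm, pow_succ', mul_assoc]
    exact (hstep _ _ _ he).trans (mul_le_mul_of_nonneg_left ih hq)

end

section

variable {n k m : ℕ}

/-! ### Families with a unique decomposition -/

/-- The families in which every row lies in at most `d` row sets and two row sets share fewer
than `s` rows, and likewise for columns. When `d ^ 2 * s ≤ k` the union of such a family determines
its rectangles. -/
noncomputable def sparseTuples (n k m d s : ℕ) :
    Finset ((Fin m → Finset (Fin n)) × (Fin m → Finset (Fin n))) := by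
  classical
  exact (rectTuples n k m).filter fun τ =>
    ((∀ x, (Finset.univ.filter fun i => x ∈ τ.1 i).card ≤ d) ∧
      ∀ i j, i ≠ j → (τ.1 i ∩ τ.1 j).card < s) ∧
    (∀ x, (Finset.univ.filter fun i => x ∈ τ.2 i).card ≤ d) ∧
      ∀ i j, i ≠ j → (τ.2 i ∩ τ.2 j).card < s

lemma mem_sparseTuples {d s : ℕ} {τ : (Fin m → Finset (Fin n)) × (Fin m → Finset (Fin n))} :
    τ ∈ sparseTuples n k m d s ↔ τ ∈ rectTuples n k m ∧
    ((∀ x, (Finset.univ.filter fun i => x ∈ τ.1 i).card ≤ d) ∧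
      ∀ i j, i ≠ j → (τ.1 i ∩ τ.1 j).card < s) ∧
    (∀ x, (Finset.univ.filter fun i => x ∈ τ.2 i).card ≤ d) ∧
      ∀ i j, i ≠ j → (τ.2 i ∩ τ.2 j).card < s := by
  simp [sparseTuples]

/-- If a rectangle covered by the family meets `S i` in at least `k / d` rows, a column `y` of it
outside `T i` would put `k / d ^ 2` of these rows into another `S j`. -/
lemma subset_of_card_inter {d s : ℕ} (hs : d ^ 2 * s ≤ k) {S T : Fin m → Finset (Fin n)}
    (hcol : ∀ y, (Finset.univ.filter fun i => y ∈ T i).card ≤ d)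
    (hinter : ∀ i j, i ≠ j → (S i ∩ S j).card < s) {A B : Finset (Fin n)}
    (hAB : ∀ x ∈ A, ∀ y ∈ B, ∃ i, x ∈ S i ∧ y ∈ T i) {i : Fin m}
    (hi : k ≤ d * (A ∩ S i).card) (hk : 0 < k) : B ⊆ T i := by
  classical
  intro y hy
  by_contra hyi
  set J := Finset.univ.filter fun j => y ∈ T j with hJ
  have hcover : A ∩ S i ⊆ J.biUnion fun j => S i ∩ S j := by
    intro x hx
    rw [Finset.mem_inter] at hx
    obtain ⟨j, hxj, hyj⟩ := hAB x hx.1 y hy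
    exact Finset.mem_biUnion.2 ⟨j, by simp [hJ, hyj], Finset.mem_inter.2 ⟨hx.2, hxj⟩⟩
  have hpos : 0 < (A ∩ S i).card := by
    rcases Nat.eq_zero_or_pos (A ∩ S i).card with h | h
    · rw [h] at hi; omega
    · exact h
  have hJne : J.Nonempty := by
    obtain ⟨x, hx⟩ := Finset.card_pos.1 hpos
    obtain ⟨j, hj, -⟩ := Finset.mem_biUnion.1 (hcover hx)
    exact ⟨j, hj⟩
  have hlt : (A ∩ S i).card < J.card * s := by
    refine (Finset.card_le_card hcover).trans_lt (Finset.card_biUnion_le.trans_lt ?_)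
    rw [← smul_eq_mul, ← Finset.sum_const]
    refine Finset.sum_lt_sum_of_nonempty hJne fun j hj => hinter i j ?_
    rintro rfl
    exact hyi (by simpa [hJ] using hj)
  have hd : 0 < d := hJne.card_pos.trans_le (hcol y)
  have h1 : (A ∩ S i).card < d * s := hlt.trans_le (Nat.mul_le_mul_right s (hcol y))
  have h2 : d * (A ∩ S i).card < d * (d * s) := Nat.mul_lt_mul_of_pos_left h1 hd
  have h3 : d * (d * s) = d ^ 2 * s := by ring
  omega

/-- A `k × k` rectangle inside the union of a sparse family is one of its rectangles. -/
lemma exists_eq_of_subset_rectUnion {d s : ℕ} (hk : 0 < k) (hs : d ^ 2 * s ≤ k)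
    {τ : (Fin m → Finset (Fin n)) × (Fin m → Finset (Fin n))} (hτ : τ ∈ sparseTuples n k m d s)
    {A B : Finset (Fin n)} (hA : A.card = k) (hB : B.card = k)
    (hAB : A ×ˢ B ⊆ rectUnion τ) : ∃ i, A = τ.1 i ∧ B = τ.2 i := by
  classical
  rw [mem_sparseTuples, mem_rectTuples] at hτ
  obtain ⟨⟨hS, hT, -⟩, ⟨hrow, hSS⟩, ⟨hcol, hTT⟩⟩ := hτ
  have hcov : ∀ x ∈ A, ∀ y ∈ B, ∃ i, x ∈ τ.1 i ∧ y ∈ τ.2 i := fun x hx y hy =>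
    mem_rectUnion.1 (hAB (Finset.mk_mem_product hx hy))
  have hcov' : ∀ y ∈ B, ∀ x ∈ A, ∃ i, y ∈ τ.2 i ∧ x ∈ τ.1 i := fun y hy x hx =>
    (hcov x hx y hy).imp fun i h => h.symm
  -- Fix one column of the rectangle: at most `d` of the row sets cover the `k` rows of `A`.
  obtain ⟨y, hy⟩ : B.Nonempty := Finset.card_pos.1 (hB ▸ hk)
  set J := Finset.univ.filter fun j => y ∈ τ.2 j with hJ
  have hAJ : A ⊆ J.biUnion fun j => A ∩ τ.1 j := by
    intro x hx
    obtain ⟨j, hxj, hyj⟩ := hcov x hx y hy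
    exact Finset.mem_biUnion.2 ⟨j, by simp [hJ, hyj], Finset.mem_inter.2 ⟨hx, hxj⟩⟩
  have hex : ∃ i, k ≤ d * (A ∩ τ.1 i).card := by
    by_contra! hcon
    have h1 : k ≤ ∑ j ∈ J, (A ∩ τ.1 j).card :=
      hA ▸ (Finset.card_le_card hAJ).trans Finset.card_biUnion_le
    have hJne : J.Nonempty := by
      obtain ⟨x, hx⟩ : A.Nonempty := Finset.card_pos.1 (hA ▸ hk)
      obtain ⟨j, hj, -⟩ := Finset.mem_biUnion.1 (hAJ hx)
      exact ⟨j, hj⟩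
    have h2 : d * k ≤ ∑ j ∈ J, d * (A ∩ τ.1 j).card := by
      rw [← Finset.mul_sum]
      exact Nat.mul_le_mul_left d h1
    have h3 : ∑ j ∈ J, d * (A ∩ τ.1 j).card < ∑ j ∈ J, k :=
      Finset.sum_lt_sum_of_nonempty hJne fun j _ => hcon j
    rw [Finset.sum_const, smul_eq_mul] at h3
    have h4 : J.card * k ≤ d * k := Nat.mul_le_mul_right k (hcol y)
    omega
  obtain ⟨i, hi⟩ := hex
  have hBi : B = τ.2 i := Finset.eq_of_subset_of_card_le
    (subset_of_card_inter hs hcol hSS hcov hi hk) (by rw [hT, hB])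
  have hd : 0 < d := by
    rcases Nat.eq_zero_or_pos d with h | h
    · rw [h] at hi; omega
    · exact h
  have hAi : A = τ.1 i := Finset.eq_of_subset_of_card_le
    (subset_of_card_inter hs hrow hTT hcov' (i := i) (by
      rw [← hBi, Finset.inter_self, hB]
      exact Nat.le_mul_of_pos_left k hd) hk) (by rw [hS, hA])
  exact ⟨i, hAi, hBi⟩

lemma injective_of_mem_rectTuples (hk : 0 < k)
    {τ : (Fin m → Finset (Fin n)) × (Fin m → Finset (Fin n))} (hτ : τ ∈ rectTuples n k m) :
    Function.Injective fun i => (τ.1 i, τ.2 i) := by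
  rw [mem_rectTuples] at hτ
  intro i j hij
  by_contra hne
  simp only [Prod.mk.injEq] at hij
  rcases hτ.2.2 i j hne with h | h
  · rw [← hij.1, disjoint_self, Finset.bot_eq_empty, ← Finset.card_eq_zero, hτ.1] at h
    omega
  · rw [← hij.2, disjoint_self, Finset.bot_eq_empty, ← Finset.card_eq_zero, hτ.2.1] at h
    omega

/-- Every planted set comes from at least `m!` ordered families. -/
lemma factorial_mul_card_filter_plantedSets_le (hk : 0 < k) (p : Finset (Fin n × Fin n) → Prop)
    [DecidablePred p] :
    m.factorial * ((plantedSets n k m).filter p).card ≤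
      ((rectTuples n k m).filter fun τ => p (rectUnion τ)).card := by
  classical
  have hex : ∀ K : Finset (Fin n × Fin n), ∃ τ, K ∈ plantedSets n k m →
      τ ∈ rectTuples n k m ∧ rectUnion τ = K := by
    intro K
    by_cases h : K ∈ plantedSets n k m
    · obtain ⟨τ, h1, h2⟩ := mem_plantedSets.1 h
      exact ⟨τ, fun _ => ⟨h1, h2⟩⟩
    · exact ⟨(fun _ => ∅, fun _ => ∅), fun h' => absurd h' h⟩
  choose t ht using hex
  have hunion : ∀ (π : Equiv.Perm (Fin m)) τ,
      rectUnion ((τ.1 ∘ π, τ.2 ∘ π) : (Fin m → Finset (Fin n)) × (Fin m → Finset (Fin n))) =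
        rectUnion τ := by
    intro π τ
    ext e
    simp only [mem_rectUnion, Function.comp]
    exact ⟨fun ⟨i, hi⟩ => ⟨π i, hi⟩, fun ⟨i, hi⟩ => ⟨π.symm i, by simpa using hi⟩⟩
  have hcard : m.factorial * ((plantedSets n k m).filter p).card =
      ((Finset.univ : Finset (Equiv.Perm (Fin m))) ×ˢ (plantedSets n k m).filter p).card := by
    rw [Finset.card_product, Finset.card_univ, Fintype.card_perm, Fintype.card_fin]
  rw [hcard]
  refine Finset.card_le_card_of_injOn (fun a => ((t a.2).1 ∘ a.1, (t a.2).2 ∘ a.1)) ?_ ?_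
  · rintro ⟨π, K⟩ h
    simp only [Finset.coe_product, Set.mem_prod, Finset.mem_coe, Finset.mem_filter] at h
    obtain ⟨h1, h2⟩ := ht K h.2.1
    rw [Finset.mem_coe, Finset.mem_filter, hunion, h2, mem_rectTuples]
    rw [mem_rectTuples] at h1
    exact ⟨⟨fun i => h1.1 _, fun i => h1.2.1 _, fun i j hij => h1.2.2 _ _ (π.injective.ne hij)⟩,
      h.2.2⟩
  · rintro ⟨π, K⟩ h ⟨π', K'⟩ h' heq
    simp only [Finset.coe_product, Set.mem_prod, Finset.mem_coe, Finset.mem_filter] at h h'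
    have hK : K = K' := by
      have := congrArg rectUnion heq
      simp only at this
      rwa [hunion, hunion, (ht K h.2.1).2, (ht K' h'.2.1).2] at this
    subst hK
    simp only [Prod.mk.injEq] at heq ⊢
    refine ⟨Equiv.ext fun i => injective_of_mem_rectTuples hk (ht K h.2.1).1 ?_, trivial⟩
    exact Prod.ext (congrFun heq.1 i) (congrFun heq.2 i)

/-- A planted set comes from at most `m!` sparse families. -/
lemma card_sparseTuples_le {d s : ℕ} (hk : 0 < k) (hs : d ^ 2 * s ≤ k) :
    (sparseTuples n k m d s).card ≤ m.factorial * (plantedSets n k m).card := by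
  classical
  refine Finset.card_le_mul_card_image_of_maps_to (f := rectUnion)
    (fun τ hτ => mem_plantedSets.2 ⟨τ, (mem_sparseTuples.1 hτ).1, rfl⟩) _ fun K _ => ?_
  rcases ((sparseTuples n k m d s).filter fun τ => rectUnion τ = K).eq_empty_or_nonempty
    with h | ⟨τ₀, h₀⟩
  · simp [h]
  rw [Finset.mem_filter] at h₀
  have hperm : m.factorial = (Finset.univ : Finset (Equiv.Perm (Fin m))).card := by
    rw [Finset.card_univ, Fintype.card_perm, Fintype.card_fin]
  rw [hperm]
  refine (Finset.card_le_card fun τ hτ => ?_).trans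
    (Finset.card_image_le (f := fun π : Equiv.Perm (Fin m) => (τ₀.1 ∘ π, τ₀.2 ∘ π)))
  rw [Finset.mem_filter] at hτ
  have hτr := (mem_sparseTuples.1 hτ.1).1
  have hτc := mem_rectTuples.1 hτr
  have hex : ∀ i, ∃ j, τ.1 i = τ₀.1 j ∧ τ.2 i = τ₀.2 j := fun i => by
    refine exists_eq_of_subset_rectUnion hk hs h₀.1 (hτc.1 i) (hτc.2.1 i) ?_
    rw [h₀.2, ← hτ.2]
    exact Finset.subset_biUnion_of_mem (fun i => τ.1 i ×ˢ τ.2 i) (Finset.mem_univ i)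
  choose g hg using hex
  have hinj : Function.Injective g := fun i j hij =>
    injective_of_mem_rectTuples hk hτr (by simp only [(hg i).1, (hg i).2, (hg j).1, (hg j).2, hij])
  refine Finset.mem_image.2 ⟨Equiv.ofBijective g (Finite.injective_iff_bijective.1 hinj),
    Finset.mem_univ _, ?_⟩
  exact Prod.ext (funext fun i => (hg i).1.symm) (funext fun i => (hg i).2.symm)

/-- At least half of the families are sparse. -/
lemma card_rectTuples_le_two_mul {d s : ℕ} (hn : 0 < n) (hmk : 2 * (m * k) ≤ n)
    (h : 2 * (n * (m * (2 * k / n : ℝ)) ^ (d + 1)) +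
      2 * (m ^ 2 * (n.choose s * (2 * k / n : ℝ) ^ (2 * s))) ≤ 1 / 2) :
    ((rectTuples n k m).card : ℝ) ≤ 2 * (sparseTuples n k m d s).card := by
  classical
  set q : ℝ := 2 * k / n with hq
  have hq0 : 0 ≤ q := by positivity
  set N : ℝ := ((rectTuples n k m).card : ℝ) with hN
  set row : Fin n × Finset (Fin m) → Finset (Fin n × Fin m) := fun a => {a.1} ×ˢ a.2
  set pair : (Fin m × Fin m) × Finset (Fin n) → Finset (Fin n × Fin m) :=
    fun a => a.2 ×ˢ {a.1.1, a.1.2}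
  set I₁ := (Finset.univ : Finset (Fin n)) ×ˢ (Finset.univ : Finset (Fin m)).powersetCard (d + 1)
  set I₂ := (Finset.univ : Finset (Fin m)).offDiag ×ˢ
    (Finset.univ : Finset (Fin n)).powersetCard s
  have hcover : rectTuples n k m ⊆ sparseTuples n k m d s ∪
      ((I₁.biUnion fun a => incidentTuples n k m (row a) ∅) ∪
       (I₂.biUnion fun a => incidentTuples n k m (pair a) ∅) ∪
       ((I₁.biUnion fun a => incidentTuples n k m ∅ (row a)) ∪
       (I₂.biUnion fun a => incidentTuples n k m ∅ (pair a)))) := by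
    intro τ hτ
    have hrow : ∀ U : Fin m → Finset (Fin n),
        ¬ (∀ x, (Finset.univ.filter fun i => x ∈ U i).card ≤ d) →
        ∃ a ∈ I₁, ∀ e ∈ row a, e.1 ∈ U e.2 := by
      intro U hU
      push Not at hU
      obtain ⟨x, hx⟩ := hU
      obtain ⟨A, hA, hAc⟩ := Finset.exists_subset_card_eq (Nat.succ_le_of_lt hx)
      refine ⟨(x, A), by simp [I₁, Finset.mem_powersetCard, hAc], ?_⟩
      rintro ⟨z, i⟩ he
      simp only [row, Finset.mem_product, Finset.mem_singleton] at he
      have := hA he.2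
      rw [Finset.mem_filter] at this
      rw [he.1]
      exact this.2
    have hpair : ∀ U : Fin m → Finset (Fin n),
        ¬ (∀ i j, i ≠ j → (U i ∩ U j).card < s) →
        ∃ a ∈ I₂, ∀ e ∈ pair a, e.1 ∈ U e.2 := by
      intro U hU
      push Not at hU
      obtain ⟨i, j, hij, hx⟩ := hU
      obtain ⟨A, hA, hAc⟩ := Finset.exists_subset_card_eq hx
      refine ⟨((i, j), A), by simp [I₂, Finset.mem_powersetCard, hAc, hij], ?_⟩
      rintro ⟨z, l⟩ he
      simp only [pair, Finset.mem_product, Finset.mem_insert, Finset.mem_singleton] at he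
      have := Finset.mem_inter.1 (hA he.1)
      rcases he.2 with rfl | rfl
      · exact this.1
      · exact this.2
    by_contra hcon
    simp only [Finset.mem_union, Finset.mem_biUnion, mem_incidentTuples, mem_sparseTuples, hτ,
      true_and, Finset.notMem_empty, false_implies, implies_true, and_true, not_or] at hcon
    obtain ⟨h0, ⟨h1, h2⟩, h3, h4⟩ := hcon
    exact h0 ⟨⟨not_not.1 fun hc => h1 (hrow _ hc), not_not.1 fun hc => h2 (hpair _ hc)⟩,
      ⟨not_not.1 fun hc => h3 (hrow _ hc), not_not.1 fun hc => h4 (hpair _ hc)⟩⟩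
  have hI₁ : ∀ a ∈ I₁, (row a).card = d + 1 := by
    rintro ⟨x, A⟩ ha
    simp only [I₁, Finset.mem_product, Finset.mem_powersetCard] at ha
    simp [row, ha.2.2]
  have hI₂ : ∀ a ∈ I₂, (pair a).card = 2 * s := by
    rintro ⟨⟨i, j⟩, A⟩ ha
    simp only [I₂, Finset.mem_product, Finset.mem_powersetCard, Finset.mem_offDiag] at ha
    simp only [pair, Finset.card_product, Finset.card_pair ha.1.2.2, ha.2.2]
    ring
  have hI₁c : (I₁.card : ℝ) ≤ n * (m : ℝ) ^ (d + 1) := by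
    simp only [I₁, Finset.card_product, Finset.card_powersetCard, Finset.card_univ,
      Fintype.card_fin]
    exact_mod_cast Nat.mul_le_mul_left n (Nat.choose_le_pow m (d + 1))
  have hI₂c : (I₂.card : ℝ) ≤ (m : ℝ) ^ 2 * n.choose s := by
    simp only [I₂, Finset.card_product, Finset.card_powersetCard, Finset.card_univ,
      Fintype.card_fin, Finset.offDiag_card]
    have : m * m - m ≤ m ^ 2 := by rw [sq]; exact Nat.sub_le _ _
    exact_mod_cast Nat.mul_le_mul_right _ this
  have hb : ∀ {ι : Type} (I : Finset ι) (c : ℕ) (f g : ι → Finset (Fin n × Fin m)),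
      (∀ a ∈ I, (f a).card + (g a).card = c) →
      (((I.biUnion fun a => incidentTuples n k m (f a) (g a)).card : ℕ) : ℝ) ≤
        I.card * (q ^ c * N) := by
    intro ι I c f g hc
    have h1 : (((I.biUnion fun a => incidentTuples n k m (f a) (g a)).card : ℕ) : ℝ) ≤
        ∑ a ∈ I, ((incidentTuples n k m (f a) (g a)).card : ℝ) := by
      exact_mod_cast Finset.card_biUnion_le
    refine h1.trans ?_
    rw [← nsmul_eq_mul, ← Finset.sum_const]
    refine Finset.sum_le_sum fun a ha => ?_
    rw [← hc a ha]
    exact card_incidentTuples_le hn hmk _ _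
  have hA1 := hb I₁ (d + 1) row (fun _ => ∅) fun a ha => by simp [hI₁ a ha]
  have hA2 := hb I₁ (d + 1) (fun _ => ∅) row fun a ha => by simp [hI₁ a ha]
  have hB1 := hb I₂ (2 * s) pair (fun _ => ∅) fun a ha => by simp [hI₂ a ha]
  have hB2 := hb I₂ (2 * s) (fun _ => ∅) pair fun a ha => by simp [hI₂ a ha]
  have hN0 : 0 ≤ N := by positivity
  have hA : (I₁.card : ℝ) * (q ^ (d + 1) * N) ≤ n * (m * q) ^ (d + 1) * N := by
    refine (mul_le_mul_of_nonneg_right hI₁c (by positivity)).trans (le_of_eq ?_)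
    rw [mul_pow]
    ring
  have hB : (I₂.card : ℝ) * (q ^ (2 * s) * N) ≤ m ^ 2 * (n.choose s * q ^ (2 * s)) * N := by
    refine (mul_le_mul_of_nonneg_right hI₂c (by positivity)).trans (le_of_eq ?_)
    ring
  have htot : N ≤ (sparseTuples n k m d s).card +
      (((I₁.biUnion fun a => incidentTuples n k m (row a) ∅).card +
       (I₂.biUnion fun a => incidentTuples n k m (pair a) ∅).card) +
       ((I₁.biUnion fun a => incidentTuples n k m ∅ (row a)).card +
       (I₂.biUnion fun a => incidentTuples n k m ∅ (pair a)).card) : ℝ) := by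
    have := (Finset.card_le_card hcover).trans ((Finset.card_union_le _ _).trans
      (Nat.add_le_add_left ((Finset.card_union_le _ _).trans
        (Nat.add_le_add (Finset.card_union_le _ _) (Finset.card_union_le _ _))) _))
    rw [hN]
    exact_mod_cast this
  have hfin := mul_le_mul_of_nonneg_right h hN0
  linarith

/-- The probability that a uniform planted set contains given cells is, up to a factor `2`, at
most a sum over the assignments `f` of the cells to rectangles, in which every incidence costs
`2 k / n`. -/
lemma card_filter_subset_plantedSets_le {d s : ℕ} (hn : 0 < n) (hk : 0 < k) (hs : d ^ 2 * s ≤ k)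
    (hmk : 2 * (m * k) ≤ n)
    (h : 2 * (n * (m * (2 * k / n : ℝ)) ^ (d + 1)) +
      2 * (m ^ 2 * (n.choose s * (2 * k / n : ℝ) ^ (2 * s))) ≤ 1 / 2)
    (F : Finset (Fin n × Fin n)) :
    (((plantedSets n k m).filter fun K => F ⊆ K).card : ℝ) ≤ 2 * (plantedSets n k m).card *
      ∑ f : F → Fin m, (2 * k / n : ℝ) ^
        ((Finset.univ.image fun e : F => (e.1.1, f e)).card +
          (Finset.univ.image fun e : F => (e.1.2, f e)).card) := by
  classical
  set W : ℝ := ∑ f : F → Fin m, (2 * k / n : ℝ) ^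
        ((Finset.univ.image fun e : F => (e.1.1, f e)).card +
          (Finset.univ.image fun e : F => (e.1.2, f e)).card) with hW
  have h1 : (m.factorial : ℝ) * ((plantedSets n k m).filter fun K => F ⊆ K).card ≤
      ((rectTuples n k m).filter fun τ => F ⊆ rectUnion τ).card := by
    exact_mod_cast factorial_mul_card_filter_plantedSets_le hk fun K => F ⊆ K
  have h2 : (((rectTuples n k m).filter fun τ => F ⊆ rectUnion τ).card : ℝ) ≤
      W * (rectTuples n k m).card := by
    have hsub : ((rectTuples n k m).filter fun τ => F ⊆ rectUnion τ) ⊆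
        (Finset.univ : Finset (F → Fin m)).biUnion fun f => incidentTuples n k m
          (Finset.univ.image fun e : F => (e.1.1, f e))
          (Finset.univ.image fun e : F => (e.1.2, f e)) := by
      intro τ hτ
      rw [Finset.mem_filter] at hτ
      have hex : ∀ e : F, ∃ i, e.1.1 ∈ τ.1 i ∧ e.1.2 ∈ τ.2 i := fun e =>
        mem_rectUnion.1 (hτ.2 e.2)
      choose f hf using hex
      refine Finset.mem_biUnion.2 ⟨f, Finset.mem_univ _, mem_incidentTuples.2 ⟨hτ.1, ?_, ?_⟩⟩
      · intro e he
        obtain ⟨a, -, rfl⟩ := Finset.mem_image.1 he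
        exact (hf a).1
      · intro e he
        obtain ⟨a, -, rfl⟩ := Finset.mem_image.1 he
        exact (hf a).2
    have hc : (((rectTuples n k m).filter fun τ => F ⊆ rectUnion τ).card : ℝ) ≤
        ∑ f : F → Fin m, ((incidentTuples n k m
          (Finset.univ.image fun e : F => (e.1.1, f e))
          (Finset.univ.image fun e : F => (e.1.2, f e))).card : ℝ) := by
      exact_mod_cast (Finset.card_le_card hsub).trans Finset.card_biUnion_le
    refine hc.trans ?_
    rw [hW, Finset.sum_mul]
    exact Finset.sum_le_sum fun f _ => card_incidentTuples_le hn hmk _ _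
  have h3 := card_rectTuples_le_two_mul (d := d) (s := s) hn hmk h
  have h4 : ((sparseTuples n k m d s).card : ℝ) ≤ m.factorial * (plantedSets n k m).card := by
    exact_mod_cast card_sparseTuples_le hk hs
  have hW0 : 0 ≤ W := Finset.sum_nonneg fun f _ => by positivity
  have hm : (0 : ℝ) < m.factorial := by positivity
  refine le_of_mul_le_mul_left ?_ hm
  calc _ ≤ W * (rectTuples n k m).card := h1.trans h2
    _ ≤ W * (2 * (m.factorial * (plantedSets n k m).card)) :=
        mul_le_mul_of_nonneg_left (h3.trans (by linarith)) hW0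
    _ = _ := by ring

end

section

variable {n k m : ℕ}

/-! ### The probability that given cells are planted -/

lemma exists_subset_image_eq_card_le {α β : Type*} [DecidableEq α] [DecidableEq β]
    (E : Finset α) (f : α → β) : ∃ F ⊆ E, F.image f = E.image f ∧ F.card ≤ (E.image f).card := by
  have hex : ∀ b : E.image f, ∃ a ∈ E, f a = b := fun b => Finset.mem_image.1 b.2
  choose g hg hfg using hex
  refine ⟨(E.image f).attach.image g, ?_, ?_, ?_⟩
  · intro a ha
    obtain ⟨b, -, rfl⟩ := Finset.mem_image.1 ha
    exact hg b
  · ext b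
    simp only [Finset.image_image, Finset.mem_image, Finset.mem_attach, true_and,
      Function.comp, hfg]
    constructor
    · rintro ⟨b, rfl⟩
      exact Finset.mem_image.1 b.2
    · intro hb
      exact ⟨⟨b, Finset.mem_image.2 hb⟩, rfl⟩
  · exact Finset.card_image_le.trans (by rw [Finset.card_attach])

/-- A bipartite graph has an edge cover with at most as many edges as it has vertices. -/
lemma exists_edge_cover {α β : Type*} [DecidableEq α] [DecidableEq β] (E : Finset (α × β)) :
    ∃ F ⊆ E, F.image Prod.fst = E.image Prod.fst ∧ F.image Prod.snd = E.image Prod.snd ∧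
      F.card ≤ (E.image Prod.fst).card + (E.image Prod.snd).card := by
  obtain ⟨F, hF, h1, h2⟩ := exists_subset_image_eq_card_le E Prod.fst
  obtain ⟨G, hG, h3, h4⟩ := exists_subset_image_eq_card_le E Prod.snd
  refine ⟨F ∪ G, Finset.union_subset hF hG, ?_, ?_, (Finset.card_union_le _ _).trans
    (Nat.add_le_add h2 h4)⟩
  · rw [Finset.image_union, h1]
    exact Finset.union_eq_left.2 (Finset.image_subset_image hG)
  · rw [Finset.image_union, h3]
    exact Finset.union_eq_right.2 (Finset.image_subset_image hF)

/-- Maps into `m` labels, weighted by `1 / m` for each label used. -/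
lemma sum_inv_pow_card_image_le {ι : Type*} [Fintype ι] [DecidableEq ι] (hm : 0 < m) :
    ∑ f : ι → Fin m, ((m : ℝ) ^ (Finset.univ.image f).card)⁻¹ ≤
      (Fintype.card ι + 1) * (Fintype.card ι : ℝ) ^ Fintype.card ι := by
  classical
  set a := Fintype.card ι with ha
  have hm' : (0 : ℝ) < m := by exact_mod_cast hm
  have hmaps : ∀ f ∈ (Finset.univ : Finset (ι → Fin m)), (Finset.univ.image f).card ∈
      Finset.range (a + 1) := fun f _ =>
    Finset.mem_range.2 (Nat.lt_succ_of_le (Finset.card_image_le.trans (by simp [ha])))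
  rw [← Finset.sum_fiberwise_of_maps_to hmaps]
  have hb : ∀ b ∈ Finset.range (a + 1), ∑ f ∈ Finset.univ.filter
      (fun f : ι → Fin m => (Finset.univ.image f).card = b),
      ((m : ℝ) ^ (Finset.univ.image f).card)⁻¹ ≤ (a : ℝ) ^ a := by
    intro b hb
    have h1 : (Finset.univ.filter (fun f : ι → Fin m => (Finset.univ.image f).card = b)).card ≤
        m ^ b * a ^ a := by
      have hsub : Finset.univ.filter (fun f : ι → Fin m => (Finset.univ.image f).card = b) ⊆
          ((Finset.univ : Finset (Fin m)).powersetCard b).biUnion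
            fun B => Fintype.piFinset fun _ : ι => B := by
        intro f hf
        rw [Finset.mem_filter] at hf
        refine Finset.mem_biUnion.2 ⟨Finset.univ.image f, by simp [Finset.mem_powersetCard, hf.2],
          Fintype.mem_piFinset.2 fun i => Finset.mem_image_of_mem f (Finset.mem_univ i)⟩
      refine (Finset.card_le_card hsub).trans (Finset.card_biUnion_le.trans ?_)
      calc _ = ∑ B ∈ (Finset.univ : Finset (Fin m)).powersetCard b, b ^ a :=
            Finset.sum_congr rfl fun B hB => by
              simp [ha, (Finset.mem_powersetCard.1 hB).2]
        _ = m.choose b * b ^ a := by simp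
        _ ≤ m ^ b * a ^ a := Nat.mul_le_mul (Nat.choose_le_pow m b)
            (Nat.pow_le_pow_left (Nat.lt_succ_iff.1 (Finset.mem_range.1 hb)) a)
    set G := Finset.univ.filter (fun f : ι → Fin m => (Finset.univ.image f).card = b) with hG
    calc ∑ f ∈ G, ((m : ℝ) ^ (Finset.univ.image f).card)⁻¹ = ∑ f ∈ G, ((m : ℝ) ^ b)⁻¹ :=
          Finset.sum_congr rfl fun f hf => by rw [(Finset.mem_filter.1 hf).2]
      _ = (G.card : ℝ) * ((m : ℝ) ^ b)⁻¹ := by rw [Finset.sum_const, nsmul_eq_mul]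
      _ ≤ ((m : ℝ) ^ b * (a : ℝ) ^ a) * ((m : ℝ) ^ b)⁻¹ :=
          mul_le_mul_of_nonneg_right (by exact_mod_cast h1) (by positivity)
      _ = (a : ℝ) ^ a := by field_simp
  refine (Finset.sum_le_sum hb).trans (le_of_eq ?_)
  simp

/-- With `A` row incidences, `B` column incidences and `b` rectangles used, each rectangle beyond
`c` costs at least one more incidence, and `m * q ≤ 1`. -/
lemma pow_mul_pow_le_of_le {q : ℝ} (hm : 0 < m) (hq : 0 ≤ q) (hmq : m * q ≤ 1)
    {A B b r c : ℕ} (hA : r ≤ A) (hBc : c ≤ B) (hBb : b ≤ B) :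
    (m : ℝ) ^ b * q ^ (A + B) ≤ (m : ℝ) ^ c * q ^ (r + c) := by
  have hm1 : (1 : ℝ) ≤ m := by exact_mod_cast hm
  have hq1 : q ≤ 1 := by nlinarith
  rcases le_total b c with h | h
  · exact mul_le_mul (pow_le_pow_right₀ hm1 h) (pow_le_pow_of_le_one hq hq1 (by omega))
      (by positivity) (by positivity)
  · obtain ⟨t, rfl⟩ := Nat.exists_eq_add_of_le h
    have h1 : q ^ (A + B) ≤ q ^ (r + c + t) := pow_le_pow_of_le_one hq hq1 (by omega)
    calc _ ≤ (m : ℝ) ^ (c + t) * q ^ (r + c + t) :=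
          mul_le_mul_of_nonneg_left h1 (by positivity)
      _ = (m : ℝ) ^ c * q ^ (r + c) * (m * q) ^ t := by rw [mul_pow]; ring
      _ ≤ (m : ℝ) ^ c * q ^ (r + c) * 1 :=
          mul_le_mul_of_nonneg_left (pow_le_one₀ (by positivity) hmq) (by positivity)
      _ = _ := mul_one _

/-- The hypotheses on the sizes under which a random family of disjoint rectangles is sparse with
probability at least `1 / 2`. -/
structure SparseRegime (n k m d s : ℕ) : Prop where
  n_pos : 0 < n
  k_pos : 0 < k
  m_pos : 0 < m
  sq_mul_le : d ^ 2 * s ≤ k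
  two_mul_le : 2 * (m * k) ≤ n
  half : 2 * (n * (m * (2 * k / n : ℝ)) ^ (d + 1)) +
      2 * (m ^ 2 * (n.choose s * (2 * k / n : ℝ) ^ (2 * s))) ≤ 1 / 2

/-- Cells that span `r` rows and `c` columns are all planted with probability at most
`m ^ min r c * (k / n) ^ (r + c)`, the value for a matching with stars, up to factors that depend
on `r + c` only. -/
lemma card_filter_subset_plantedSets_le_pow {d s : ℕ} (h : SparseRegime n k m d s)
    (E : Finset (Fin n × Fin n)) {r c : ℕ} (hr : (E.image Prod.fst).card = r)
    (hc : (E.image Prod.snd).card = c) :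
    (((plantedSets n k m).filter fun K => E ⊆ K).card : ℝ) ≤ (plantedSets n k m).card *
      (2 * ((r + c + 1) * (r + c : ℝ) ^ (r + c)) *
        ((m : ℝ) ^ min r c * (2 * k / n : ℝ) ^ (r + c))) := by
  classical
  obtain ⟨F, hFE, h1, h2, hcard⟩ := exists_edge_cover E
  set q : ℝ := 2 * k / n with hq
  have hq0 : 0 ≤ q := by positivity
  have hn' : (0 : ℝ) < n := by exact_mod_cast h.n_pos
  have hm' : (0 : ℝ) < m := by exact_mod_cast h.m_pos
  have hmq : m * q ≤ 1 := by
    rw [hq, mul_div_assoc', div_le_one hn']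
    have : ((2 * (m * k) : ℕ) : ℝ) ≤ n := by exact_mod_cast h.two_mul_le
    push_cast at this
    linarith
  have hmono : (((plantedSets n k m).filter fun K => E ⊆ K).card : ℝ) ≤
      ((plantedSets n k m).filter fun K => F ⊆ K).card := by
    exact_mod_cast Finset.card_le_card
      (Finset.monotone_filter_right _ fun K _ hK => hFE.trans hK)
  refine (hmono.trans (card_filter_subset_plantedSets_le h.n_pos h.k_pos h.sq_mul_le
    h.two_mul_le h.half F)).trans ?_
  rw [mul_comm (2 : ℝ), mul_assoc]
  refine mul_le_mul_of_nonneg_left ?_ (Nat.cast_nonneg _)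
  rw [mul_assoc]
  refine mul_le_mul_of_nonneg_left ?_ zero_le_two
  rw [hr, hc] at hcard
  have hterm : ∀ f : F → Fin m, q ^ ((Finset.univ.image fun e : F => (e.1.1, f e)).card +
      (Finset.univ.image fun e : F => (e.1.2, f e)).card) ≤
      ((m : ℝ) ^ (Finset.univ.image f).card)⁻¹ * ((m : ℝ) ^ min r c * q ^ (r + c)) := by
    intro f
    set A := (Finset.univ.image fun e : F => (e.1.1, f e)).card with hA
    set B := (Finset.univ.image fun e : F => (e.1.2, f e)).card with hB
    have hAr : r ≤ A := by
      rw [← hr, ← h1]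
      refine (Finset.card_le_card fun x hx => ?_).trans (Finset.card_image_le (f := Prod.fst))
      obtain ⟨e, he, rfl⟩ := Finset.mem_image.1 hx
      exact Finset.mem_image.2 ⟨(e.1, f ⟨e, he⟩), Finset.mem_image.2
        ⟨⟨e, he⟩, Finset.mem_univ _, rfl⟩, rfl⟩
    have hBc : c ≤ B := by
      rw [← hc, ← h2]
      refine (Finset.card_le_card fun x hx => ?_).trans (Finset.card_image_le (f := Prod.fst))
      obtain ⟨e, he, rfl⟩ := Finset.mem_image.1 hx
      exact Finset.mem_image.2 ⟨(e.2, f ⟨e, he⟩), Finset.mem_image.2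
        ⟨⟨e, he⟩, Finset.mem_univ _, rfl⟩, rfl⟩
    have hAb : (Finset.univ.image f).card ≤ A := by
      refine (Finset.card_le_card fun x hx => ?_).trans (Finset.card_image_le (f := Prod.snd))
      obtain ⟨e, he, rfl⟩ := Finset.mem_image.1 hx
      exact Finset.mem_image.2 ⟨(e.1.1, f e), Finset.mem_image.2
        ⟨e, Finset.mem_univ _, rfl⟩, rfl⟩
    have hBb : (Finset.univ.image f).card ≤ B := by
      refine (Finset.card_le_card fun x hx => ?_).trans (Finset.card_image_le (f := Prod.snd))
      obtain ⟨e, he, rfl⟩ := Finset.mem_image.1 hx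
      exact Finset.mem_image.2 ⟨(e.1.2, f e), Finset.mem_image.2
        ⟨e, Finset.mem_univ _, rfl⟩, rfl⟩
    rw [inv_mul_eq_div, le_div_iff₀ (by positivity), mul_comm]
    rcases le_total r c with hrc | hrc
    · rw [min_eq_left hrc, add_comm A, add_comm r]
      exact pow_mul_pow_le_of_le h.m_pos hq0 hmq hBc hAr hAb
    · rw [min_eq_right hrc]
      exact pow_mul_pow_le_of_le h.m_pos hq0 hmq hAr hBc hBb
  refine (Finset.sum_le_sum fun f _ => hterm f).trans ?_
  rw [← Finset.sum_mul]
  refine mul_le_mul_of_nonneg_right ?_ (by positivity)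
  refine (sum_inv_pow_card_image_le h.m_pos).trans ?_
  rw [Fintype.card_coe]
  have hv : (F.card : ℝ) ≤ r + c := by exact_mod_cast hcard
  have hpow : (F.card : ℝ) ^ F.card ≤ (r + c : ℝ) ^ (r + c) := by
    have : F.card ^ F.card ≤ (r + c) ^ (r + c) := by
      rcases Nat.eq_zero_or_pos (r + c) with h0 | h0
      · have : F.card = 0 := by omega
        rw [this, h0]
      · exact (Nat.pow_le_pow_left hcard _).trans (Nat.pow_le_pow_right h0 hcard)
    exact_mod_cast this
  exact mul_le_mul (by linarith) hpow (by positivity) (by positivity)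

/-! ### Moments of the overlap -/

/-- The overlap moment is a sum over words of `d` cells. -/
lemma sum_sum_card_inter_pow (P : Finset (Finset (Fin n × Fin n))) (d : ℕ) :
    ∑ K ∈ P, ∑ K' ∈ P, ((K ∩ K').card : ℝ) ^ d = ∑ w : Fin d → Fin n × Fin n,
      ((P.filter fun K => Finset.univ.image w ⊆ K).card : ℝ) ^ 2 := by
  classical
  have hpow : ∀ K K' : Finset (Fin n × Fin n), ((K ∩ K').card : ℝ) ^ d =
      ∑ w : Fin d → Fin n × Fin n, (if Finset.univ.image w ⊆ K then (1 : ℝ) else 0) *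
        (if Finset.univ.image w ⊆ K' then (1 : ℝ) else 0) := by
    intro K K'
    have h : (Finset.univ.filter fun w : Fin d → Fin n × Fin n =>
        Finset.univ.image w ⊆ K ∩ K') = Fintype.piFinset fun _ : Fin d => K ∩ K' := by
      ext w
      simp [Finset.image_subset_iff, Fintype.mem_piFinset]
    simp_rw [mul_ite, mul_one, mul_zero, ← ite_and]
    rw [Finset.sum_boole]
    have h2 : (Finset.univ.filter fun w : Fin d → Fin n × Fin n =>
        Finset.univ.image w ⊆ K' ∧ Finset.univ.image w ⊆ K) =
        Finset.univ.filter fun w : Fin d → Fin n × Fin n => Finset.univ.image w ⊆ K ∩ K' := by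
      ext w
      simp only [Finset.mem_filter, Finset.subset_inter_iff]
      tauto
    rw [h2, h]
    simp
  simp_rw [hpow]
  have hcard : ∀ w : Fin d → Fin n × Fin n,
      ((P.filter fun K => Finset.univ.image w ⊆ K).card : ℝ) =
        ∑ K ∈ P, if Finset.univ.image w ⊆ K then (1 : ℝ) else 0 := fun w => by
    rw [Finset.sum_boole]
  simp_rw [hcard, sq, Finset.sum_mul_sum]
  simp_rw [Finset.sum_comm (s := P) (t := Finset.univ)]

lemma card_filter_words_le (d r c : ℕ) :
    (Finset.univ.filter fun w : Fin d → Fin n × Fin n =>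
      ((Finset.univ.image w).image Prod.fst).card = r ∧
      ((Finset.univ.image w).image Prod.snd).card = c).card ≤ n ^ (r + c) * (r * c) ^ d := by
  classical
  have hsub : (Finset.univ.filter fun w : Fin d → Fin n × Fin n =>
      ((Finset.univ.image w).image Prod.fst).card = r ∧
      ((Finset.univ.image w).image Prod.snd).card = c) ⊆
      ((Finset.univ : Finset (Fin n)).powersetCard r ×ˢ
        (Finset.univ : Finset (Fin n)).powersetCard c).biUnion
          fun a => Fintype.piFinset fun _ : Fin d => a.1 ×ˢ a.2 := by
    intro w hw
    rw [Finset.mem_filter] at hw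
    refine Finset.mem_biUnion.2 ⟨((Finset.univ.image w).image Prod.fst,
      (Finset.univ.image w).image Prod.snd), by simp [Finset.mem_powersetCard, hw.2.1, hw.2.2],
      Fintype.mem_piFinset.2 fun l => Finset.mem_product.2 ⟨?_, ?_⟩⟩
    · exact Finset.mem_image_of_mem _ (Finset.mem_image_of_mem w (Finset.mem_univ l))
    · exact Finset.mem_image_of_mem _ (Finset.mem_image_of_mem w (Finset.mem_univ l))
  refine (Finset.card_le_card hsub).trans (Finset.card_biUnion_le.trans ?_)
  calc _ = ∑ a ∈ (Finset.univ : Finset (Fin n)).powersetCard r ×ˢ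
        (Finset.univ : Finset (Fin n)).powersetCard c, (r * c) ^ d :=
        Finset.sum_congr rfl fun a ha => by
          obtain ⟨h1, h2⟩ := Finset.mem_product.1 ha
          simp [(Finset.mem_powersetCard.1 h1).2, (Finset.mem_powersetCard.1 h2).2]
    _ = n.choose r * n.choose c * (r * c) ^ d := by simp
    _ ≤ n ^ (r + c) * (r * c) ^ d := by
        rw [pow_add]
        exact Nat.mul_le_mul_right _ (Nat.mul_le_mul (Nat.choose_le_pow n r)
          (Nat.choose_le_pow n c))

/-- Moments of the overlap of two independent planted sets, sorted by the numbers `r` and `c` of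
rows and columns of a word of `d` cells. -/
lemma overlap_moment_le {d₀ s : ℕ} (h : SparseRegime n k m d₀ s) {d : ℕ} (hd : 0 < d) :
    ((plantedSets n k m).card : ℝ)⁻¹ ^ 2 *
      ∑ K ∈ plantedSets n k m, ∑ K' ∈ plantedSets n k m, ((K ∩ K').card : ℝ) ^ d ≤
    ∑ a ∈ Finset.Icc 1 d ×ˢ Finset.Icc 1 d, (n : ℝ) ^ (a.1 + a.2) * (a.1 * a.2 : ℝ) ^ d *
      (2 * ((a.1 + a.2 + 1) * (a.1 + a.2 : ℝ) ^ (a.1 + a.2)) *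
        ((m : ℝ) ^ min a.1 a.2 * (2 * k / n : ℝ) ^ (a.1 + a.2))) ^ 2 := by
  classical
  rw [sum_sum_card_inter_pow]
  set N : ℝ := ((plantedSets n k m).card : ℝ) with hN
  have hmaps : ∀ w ∈ (Finset.univ : Finset (Fin d → Fin n × Fin n)),
      (((Finset.univ.image w).image Prod.fst).card,
        ((Finset.univ.image w).image Prod.snd).card) ∈ Finset.Icc 1 d ×ˢ Finset.Icc 1 d := by
    intro w _
    have hne : (Finset.univ.image w).Nonempty := ⟨w ⟨0, hd⟩, by simp⟩
    have hle : (Finset.univ.image w).card ≤ d := Finset.card_image_le.trans (by simp)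
    rw [Finset.mem_product, Finset.mem_Icc, Finset.mem_Icc]
    exact ⟨⟨(hne.image _).card_pos, Finset.card_image_le.trans hle⟩,
      (hne.image _).card_pos, Finset.card_image_le.trans hle⟩
  rw [← Finset.sum_fiberwise_of_maps_to hmaps, Finset.mul_sum]
  refine Finset.sum_le_sum fun a _ => ?_
  obtain ⟨r, c⟩ := a
  simp only
  set p : ℝ := 2 * ((r + c + 1) * (r + c : ℝ) ^ (r + c)) *
        ((m : ℝ) ^ min r c * (2 * k / n : ℝ) ^ (r + c)) with hp
  have hp0 : 0 ≤ p := by positivity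
  have hle : ∀ w ∈ Finset.univ.filter (fun w : Fin d → Fin n × Fin n =>
      (((Finset.univ.image w).image Prod.fst).card,
        ((Finset.univ.image w).image Prod.snd).card) = (r, c)),
      (((plantedSets n k m).filter fun K => Finset.univ.image w ⊆ K).card : ℝ) ^ 2 ≤
        (N * p) ^ 2 := by
    intro w hw
    have hw' := (Finset.mem_filter.1 hw).2
    rw [Prod.mk.injEq] at hw'
    exact pow_le_pow_left₀ (by positivity)
      (card_filter_subset_plantedSets_le_pow h _ hw'.1 hw'.2) 2
  have hcard : ((Finset.univ.filter (fun w : Fin d → Fin n × Fin n =>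
      (((Finset.univ.image w).image Prod.fst).card,
        ((Finset.univ.image w).image Prod.snd).card) = (r, c))).card : ℝ) ≤
        (n : ℝ) ^ (r + c) * (r * c : ℝ) ^ d := by
    simp only [Prod.mk.injEq]
    exact_mod_cast card_filter_words_le (n := n) d r c
  have hNinv : N⁻¹ ^ 2 * N ^ 2 ≤ 1 := by
    rcases eq_or_ne N 0 with h0 | h0
    · simp [h0]
    · rw [← mul_pow, inv_mul_cancel₀ h0, one_pow]
  calc _ ≤ N⁻¹ ^ 2 * (((n : ℝ) ^ (r + c) * (r * c : ℝ) ^ d) * (N * p) ^ 2) := by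
        refine mul_le_mul_of_nonneg_left ((Finset.sum_le_sum hle).trans ?_) (by positivity)
        rw [Finset.sum_const, nsmul_eq_mul]
        exact mul_le_mul_of_nonneg_right hcard (by positivity)
    _ = (N⁻¹ ^ 2 * N ^ 2) * ((n : ℝ) ^ (r + c) * (r * c : ℝ) ^ d * p ^ 2) := by ring
    _ ≤ 1 * ((n : ℝ) ^ (r + c) * (r * c : ℝ) ^ d * p ^ 2) :=
        mul_le_mul_of_nonneg_right hNinv (by positivity)
    _ = _ := one_mul _

end

section

variable {n k m : ℕ}

/-! ### Lower bound from the entries of degree one -/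

lemma rectTuples_nonempty (hmk : m * k ≤ n) : (rectTuples n k m).Nonempty := by
  classical
  have hlt : ∀ (i : Fin m) (j : Fin k), (i : ℕ) * k + j < n := fun i j => by
    have h1 : ((i : ℕ) + 1) * k ≤ m * k := Nat.mul_le_mul_right k i.2
    have h2 := j.2
    rw [add_mul] at h1
    omega
  set U : Fin m → Finset (Fin n) := fun i =>
    Finset.univ.image fun j : Fin k => (⟨(i : ℕ) * k + j, hlt i j⟩ : Fin n) with hU
  have hcard : ∀ i, (U i).card = k := fun i => by
    rw [hU, Finset.card_image_of_injective, Finset.card_univ, Fintype.card_fin]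
    intro a b hab
    simpa [Fin.ext_iff] using hab
  refine ⟨(U, U), mem_rectTuples.2 ⟨hcard, hcard, fun i j hij => Or.inl ?_⟩⟩
  refine Finset.disjoint_left.2 fun x hi hj => hij ?_
  obtain ⟨a, -, rfl⟩ := Finset.mem_image.1 hi
  obtain ⟨b, -, hb⟩ := Finset.mem_image.1 hj
  rw [Fin.mk.injEq] at hb
  have hk : 0 < k := (Nat.zero_le _).trans_lt a.2
  have h1 : ((i : ℕ) * k + a) / k = i := by
    rw [mul_comm, Nat.mul_add_div hk, Nat.div_eq_of_lt a.2, add_zero]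
  have h2 : ((j : ℕ) * k + b) / k = j := by
    rw [mul_comm, Nat.mul_add_div hk, Nat.div_eq_of_lt b.2, add_zero]
  rw [← hb, h2] at h1
  exact Fin.ext h1.symm

lemma card_of_mem_plantedSets {K : Finset (Fin n × Fin n)} (hK : K ∈ plantedSets n k m) :
    K.card = m * k ^ 2 := by
  classical
  obtain ⟨τ, hτ, rfl⟩ := mem_plantedSets.1 hK
  rw [mem_rectTuples] at hτ
  rw [rectUnion, Finset.card_biUnion]
  · simp [Finset.card_product, hτ.1, hτ.2.1, sq]
  · exact fun i _ j _ hij => Finset.disjoint_product.2 (hτ.2.2 i j hij)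

/-- The Hermite coefficients of degree one, with the Cauchy–Schwarz inequality over the cells. -/
lemma le_lowDegreeNorm (hmk : m * k ≤ n) (hn : 0 < n) {lam : ℝ} (hlam : 0 < lam) {D : ℕ}
    (hD : 1 ≤ D) : lam * (m * k ^ 2) / n ≤ lowDegreeNorm n k m lam D := by
  classical
  set P := plantedSets n k m with hP
  have hN : (0 : ℝ) < P.card := by
    obtain ⟨τ, hτ⟩ := rectTuples_nonempty hmk
    exact_mod_cast Finset.card_pos.2 ⟨_, mem_plantedSets.2 ⟨τ, hτ, rfl⟩⟩
  set N : ℝ := (P.card : ℝ) with hNdef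
  have hn' : (0 : ℝ) < n := by exact_mod_cast hn
  set c : Fin n × Fin n → ℝ := fun e => ∑ K ∈ P, if e ∈ K then (1 : ℝ) else 0 with hc
  have hsum : ∑ e, c e = N * (m * k ^ 2) := by
    rw [hc, Finset.sum_comm]
    have : ∀ K ∈ P, ∑ e, (if e ∈ K then (1 : ℝ) else 0) = m * k ^ 2 := fun K hK => by
      rw [Finset.sum_boole]
      simp only [Finset.filter_mem_eq_inter, Finset.univ_inter]
      exact_mod_cast card_of_mem_plantedSets hK
    rw [Finset.sum_congr rfl this]
    simp [hNdef]
  have hsq : ∑ K ∈ P, ∑ K' ∈ P, ((K ∩ K').card : ℝ) ^ 1 = ∑ e, c e ^ 2 := by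
    have : ∀ K K' : Finset (Fin n × Fin n), ((K ∩ K').card : ℝ) ^ 1 =
        ∑ e, (if e ∈ K then (1 : ℝ) else 0) * (if e ∈ K' then (1 : ℝ) else 0) := by
      intro K K'
      simp_rw [mul_ite, mul_one, mul_zero, ← ite_and]
      rw [Finset.sum_boole, pow_one]
      congr 2
      ext e
      simp [and_comm]
    simp_rw [this, hc, sq, Finset.sum_mul_sum, Finset.sum_comm (s := P) (t := Finset.univ)]
  have hcs : (N * (m * k ^ 2)) ^ 2 ≤ (n : ℝ) ^ 2 * ∑ e, c e ^ 2 := by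
    rw [← hsum]
    have := sq_sum_le_card_mul_sum_sq (s := (Finset.univ : Finset (Fin n × Fin n))) (f := c)
    simpa [Finset.card_univ, Fintype.card_prod, sq (n : ℝ)] using this
  have hnorm0 : 0 ≤ lowDegreeNorm n k m lam D := norm_nonneg _
  refine (pow_le_pow_iff_left₀ (by positivity) hnorm0 two_ne_zero).1 ?_
  rw [lowDegreeNorm_sq]
  have hpos : ∀ d ∈ Finset.range (D + 1), 0 ≤ (lam ^ 2) ^ d / d.factorial *
      (N⁻¹ ^ 2 * ∑ K ∈ P, ∑ K' ∈ P, ((K ∩ K').card : ℝ) ^ d) := fun d _ =>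
    mul_nonneg (by positivity) (mul_nonneg (sq_nonneg _) (Finset.sum_nonneg fun K _ =>
      Finset.sum_nonneg fun K' _ => pow_nonneg (Nat.cast_nonneg _) d))
  refine le_trans ?_ (Finset.single_le_sum hpos (Finset.mem_range.2 (Nat.lt_succ_of_le hD)))
  rw [hsq, pow_one, Nat.factorial_one, Nat.cast_one, div_one]
  have h1 : (m * k ^ 2 : ℝ) ^ 2 / n ^ 2 ≤ N⁻¹ ^ 2 * ∑ e, c e ^ 2 := by
    rw [div_le_iff₀ (by positivity), inv_pow, mul_assoc, inv_mul_eq_div,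
      le_div_iff₀ (by positivity)]
    linarith [hcs]
  calc (lam * (m * k ^ 2) / n) ^ 2 = lam ^ 2 * ((m * k ^ 2 : ℝ) ^ 2 / n ^ 2) := by ring
    _ ≤ _ := mul_le_mul_of_nonneg_left h1 (by positivity)

/-! ### Upper bound below the threshold, for fixed `n` -/

/-- Words with `r` rows and `c` columns, weighted by their squared probability and by one factor
`lam ^ 2` for each of the `max r c` cells they must have: `min r c` pairs of vertices cost
`(k ^ 2 m lam / n) ^ 2` each and the remaining vertices `k ^ 2 lam ^ 2 / n` each. -/
lemma weight_le {lam C δ : ℝ} (hn : 0 < n) (hm : 0 < m) (hlam : 0 < lam) (hC : 1 ≤ C)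
    (hlamC : lam ≤ C) (hδ : lam * (m * k ^ 2) ≤ δ * n) (r c : ℕ) :
    (n : ℝ) ^ (r + c) * ((m : ℝ) ^ min r c * (2 * k / n : ℝ) ^ (r + c)) ^ 2 *
      lam ^ (2 * max r c) ≤ (4 * C * δ) ^ (r + c) := by
  have hn' : (0 : ℝ) < n := by exact_mod_cast hn
  have hm1 : (1 : ℝ) ≤ m := by exact_mod_cast hm
  set x : ℝ := 4 * k ^ 2 / n with hx
  have hx0 : 0 ≤ x := by positivity
  have h1 : x * m * lam ≤ 4 * δ := by
    rw [hx, div_mul_eq_mul_div, div_mul_eq_mul_div, div_le_iff₀ hn']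
    linarith
  have h2 : x * lam ≤ 4 * δ := by
    refine le_trans ?_ h1
    have : 0 ≤ x * lam := by positivity
    nlinarith
  have hδ0 : 0 ≤ δ := by
    have : 0 ≤ x * lam := by positivity
    linarith
  have h3 : x * lam ^ 2 ≤ 4 * C * δ := by
    calc x * lam ^ 2 = x * lam * lam := by ring
      _ ≤ 4 * δ * C := mul_le_mul h2 hlamC hlam.le (by positivity)
      _ = _ := by ring
  have h1' : x * m * lam ≤ 4 * C * δ := h1.trans (by nlinarith)
  have hkey : ∀ a t : ℕ, (n : ℝ) ^ (a + (a + t)) *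
      ((m : ℝ) ^ a * (2 * k / n : ℝ) ^ (a + (a + t))) ^ 2 * lam ^ (2 * (a + t)) ≤
      (4 * C * δ) ^ (a + (a + t)) := by
    intro a t
    have hxn : (n : ℝ) * (2 * k / n) ^ 2 = x := by
      rw [hx]
      field_simp
      ring
    calc _ = ((n : ℝ) * (2 * k / n) ^ 2) ^ (a + (a + t)) * m ^ (2 * a) * lam ^ (2 * (a + t)) := by
          generalize (2 * k / n : ℝ) = y
          ring
      _ = (x * m * lam) ^ (2 * a) * (x * lam ^ 2) ^ t := by
          rw [hxn]
          ring
      _ ≤ (4 * C * δ) ^ (2 * a) * (4 * C * δ) ^ t :=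
          mul_le_mul (pow_le_pow_left₀ (by positivity) h1' _)
            (pow_le_pow_left₀ (by positivity) h3 _) (by positivity) (by positivity)
      _ = _ := by ring
  rcases le_total r c with h | h
  · obtain ⟨t, rfl⟩ := Nat.exists_eq_add_of_le h
    rw [min_eq_left h, max_eq_right h]
    exact hkey r t
  · obtain ⟨t, rfl⟩ := Nat.exists_eq_add_of_le h
    rw [min_eq_right h, max_eq_left h, add_comm (c + t) c]
    exact hkey c t

/-- With `δ = n ^ (-ε)` the surplus below the threshold and `H` a bound for the multiplicity of
words, every term of the expansion with `d ≥ 1` is at most `4 ρ ^ (r + c)` for a `ρ ≤ D ^ (-2)`. As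
`r + c ≥ 2`, the at most `D ^ 3` terms add up to at most `4`; the term `d = 0` adds at most `1`. -/
lemma lowDegreeNorm_sq_le {d₀ s : ℕ} (h : SparseRegime n k m d₀ s) {lam C δ H : ℝ}
    (hlam : 0 < lam) (hC : 1 ≤ C) (hlamC : lam ≤ C) (hδ : lam * (m * k ^ 2) ≤ δ * n)
    (hH : 0 ≤ H) {D : ℕ}
    (hfac : ∀ d r c : ℕ, d ≤ D → 1 ≤ r → r ≤ d → 1 ≤ c → c ≤ d →
      lam ^ (2 * (d - max r c)) * (r * c : ℝ) ^ d / d.factorial ≤ H ^ (r + c))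
    (hsmall : 64 * C * δ * D ^ 4 * H ≤ 1) : lowDegreeNorm n k m lam D ^ 2 ≤ 5 := by
  classical
  have hn' : (0 : ℝ) < n := by exact_mod_cast h.n_pos
  have hδ0 : 0 ≤ δ := by
    by_contra hcon
    have : δ * n < 0 := mul_neg_of_neg_of_pos (by linarith) hn'
    have : 0 ≤ lam * (m * k ^ 2 : ℝ) := by positivity
    linarith
  rw [lowDegreeNorm_sq, Finset.sum_range_succ']
  have h0 : (lam ^ 2) ^ 0 / (Nat.factorial 0 : ℝ) * (((plantedSets n k m).card : ℝ)⁻¹ ^ 2 *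
        ∑ K ∈ plantedSets n k m, ∑ K' ∈ plantedSets n k m, ((K ∩ K').card : ℝ) ^ 0) ≤ 1 := by
    simp only [pow_zero, Nat.factorial_zero, Nat.cast_one, div_one, one_mul, Finset.sum_const,
      nsmul_eq_mul, mul_one]
    rcases eq_or_ne ((plantedSets n k m).card : ℝ) 0 with h0 | h0
    · simp [h0]
    · rw [← sq, ← mul_pow, inv_mul_cancel₀ h0, one_pow]
  set ρ : ℝ := 64 * C * δ * D ^ 2 * H with hρ
  have hρ0 : 0 ≤ ρ := by positivity
  have hterm : ∀ d ∈ Finset.range D, (lam ^ 2) ^ (d + 1) / ((d + 1).factorial : ℝ) *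
      (((plantedSets n k m).card : ℝ)⁻¹ ^ 2 * ∑ K ∈ plantedSets n k m,
        ∑ K' ∈ plantedSets n k m, ((K ∩ K').card : ℝ) ^ (d + 1)) ≤ D ^ 2 * (4 * ρ ^ 2) := by
    intro d hd
    have hdD : d + 1 ≤ D := Finset.mem_range.1 hd
    have hD1 : (1 : ℝ) ≤ D := by exact_mod_cast (Nat.le_add_left 1 d).trans hdD
    have hρ1 : ρ ≤ 1 := by
      refine le_trans ?_ hsmall
      have : (D : ℝ) ^ 2 ≤ D ^ 4 := pow_le_pow_right₀ hD1 (by norm_num)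
      rw [hρ]
      gcongr
    refine (mul_le_mul_of_nonneg_left (overlap_moment_le h (Nat.succ_pos d))
      (by positivity)).trans ?_
    rw [Finset.mul_sum]
    have hone : ∀ a ∈ Finset.Icc 1 (d + 1) ×ˢ Finset.Icc 1 (d + 1),
        (lam ^ 2) ^ (d + 1) / ((d + 1).factorial : ℝ) *
        ((n : ℝ) ^ (a.1 + a.2) * (a.1 * a.2 : ℝ) ^ (d + 1) *
      (2 * ((a.1 + a.2 + 1) * (a.1 + a.2 : ℝ) ^ (a.1 + a.2)) *
        ((m : ℝ) ^ min a.1 a.2 * (2 * k / n : ℝ) ^ (a.1 + a.2))) ^ 2) ≤ 4 * ρ ^ 2 := by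
      rintro ⟨r, c⟩ ha
      simp only [Finset.mem_product, Finset.mem_Icc] at ha
      obtain ⟨⟨hr1, hrd⟩, hc1, hcd⟩ := ha
      simp only
      set v := r + c with hv
      have hvD : (v : ℝ) ≤ 2 * D := by
        have : v ≤ 2 * D := by omega
        exact_mod_cast this
      have hw := weight_le (k := k) h.n_pos h.m_pos hlam hC hlamC hδ r c
      rw [← hv] at hw
      have hf := hfac (d + 1) r c hdD hr1 hrd hc1 hcd
      rw [← hv] at hf
      have hcomb : ((r + c + 1) * (r + c : ℝ) ^ v) ^ 2 ≤ (16 * D ^ 2 : ℝ) ^ v := by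
        have e1 : (r + c + 1 : ℝ) ≤ 2 ^ v := by
          have : v + 1 ≤ 2 ^ v := Nat.lt_two_pow_self
          rw [hv] at this ⊢
          exact_mod_cast this
        have e2 : (r + c : ℝ) ^ v ≤ (2 * D) ^ v := by
          refine pow_le_pow_left₀ (by positivity) ?_ v
          rw [hv] at hvD
          push_cast at hvD
          exact hvD
        calc _ ≤ ((2 : ℝ) ^ v * (2 * D) ^ v) ^ 2 :=
              pow_le_pow_left₀ (by positivity) (mul_le_mul e1 e2 (by positivity)
                (by positivity)) 2
          _ = _ := by
              rw [← mul_pow, ← pow_mul, mul_comm v 2, pow_mul]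
              ring
      have hM : (lam ^ 2) ^ (d + 1) = lam ^ (2 * (d + 1 - max r c)) * lam ^ (2 * max r c) := by
        rw [← pow_mul, ← pow_add]
        congr 1
        have : max r c ≤ d + 1 := max_le hrd hcd
        omega
      calc _ = (lam ^ (2 * (d + 1 - max r c)) * (r * c : ℝ) ^ (d + 1) / (d + 1).factorial) *
            (4 * ((r + c + 1) * (r + c : ℝ) ^ v) ^ 2) *
            ((n : ℝ) ^ v * ((m : ℝ) ^ min r c * (2 * k / n : ℝ) ^ v) ^ 2 *
              lam ^ (2 * max r c)) := by
            rw [hM]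
            ring
        _ ≤ H ^ v * (4 * (16 * D ^ 2 : ℝ) ^ v) * (4 * C * δ) ^ v :=
            mul_le_mul (mul_le_mul hf (by linarith) (by positivity) (by positivity)) hw
              (by positivity) (by positivity)
        _ = 4 * ρ ^ v := by
            have : ρ = H * (16 * D ^ 2) * (4 * C * δ) := by rw [hρ]; ring
            rw [this]
            generalize (16 * D ^ 2 : ℝ) = A
            generalize 4 * C * δ = B
            ring
        _ ≤ 4 * ρ ^ 2 := by
            have : ρ ^ v ≤ ρ ^ 2 := pow_le_pow_of_le_one hρ0 hρ1 (by omega)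
            linarith
    refine (Finset.sum_le_sum hone).trans ?_
    rw [Finset.sum_const, nsmul_eq_mul, Finset.card_product, Nat.card_Icc, Nat.add_sub_cancel]
    refine mul_le_mul_of_nonneg_right ?_ (by positivity)
    have : (d + 1) * (d + 1) ≤ D ^ 2 := by
      rw [sq]
      exact Nat.mul_le_mul hdD hdD
    exact_mod_cast this
  have hsum := Finset.sum_le_sum hterm
  rw [Finset.sum_const, nsmul_eq_mul, Finset.card_range] at hsum
  have hfin : (D : ℝ) * (D ^ 2 * (4 * ρ ^ 2)) ≤ 4 := by
    rcases Nat.eq_zero_or_pos D with hD | hD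
    · simp [hD]
    · have hD1 : (1 : ℝ) ≤ D := by exact_mod_cast hD
      have h1 : D ^ 2 * ρ ≤ 1 := by
        refine le_trans (le_of_eq ?_) hsmall
        rw [hρ]
        ring
      have h2 : (D ^ 2 * ρ) ^ 2 ≤ 1 := pow_le_one₀ (by positivity) h1
      have h3 : (D : ℝ) ^ 3 ≤ D ^ 4 := pow_le_pow_right₀ hD1 (by norm_num)
      calc _ = 4 * (D ^ 3 * ρ ^ 2 : ℝ) := by ring
        _ ≤ 4 * (D ^ 4 * ρ ^ 2 : ℝ) := by gcongr
        _ = 4 * (D ^ 2 * ρ) ^ 2 := by ring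
        _ ≤ 4 := by linarith
  linarith

end

/-! ### Asymptotics -/

lemma eventually_rpow_neg_le {a c : ℝ} (ha : 0 < a) (hc : 0 < c) :
    ∀ᶠ n : ℕ in atTop, (n : ℝ) ^ (-a) ≤ c :=
  ((tendsto_rpow_neg_atTop ha).comp tendsto_natCast_atTop_atTop).eventually (eventually_le_nhds hc)

lemma eventually_le_rpow {a : ℝ} (ha : 0 < a) (c : ℝ) : ∀ᶠ n : ℕ in atTop, c ≤ (n : ℝ) ^ a :=
  ((tendsto_rpow_atTop ha).comp tendsto_natCast_atTop_atTop).eventually_ge_atTop c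

/-- The union bound for an overlap of `s` rows between two row sets, a consequence of
`s ^ s ≤ e ^ s * s!`. -/
lemma choose_mul_pow_le {n k d s : ℕ} (hn : 0 < n) (hs : 0 < s) (hks : k ≤ 2 * d ^ 2 * s) :
    (n.choose s : ℝ) * (2 * k / n : ℝ) ^ (2 * s) ≤ (24 * d ^ 2 * (k / n) : ℝ) ^ s := by
  have hn' : (0 : ℝ) < n := by exact_mod_cast hn
  have hs' : (0 : ℝ) < s := by exact_mod_cast hs
  have h1 : (n.choose s : ℝ) ≤ (n : ℝ) ^ s / s.factorial := Nat.choose_le_pow_div s n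
  have h2 : (s : ℝ) ^ s / s.factorial ≤ 3 ^ s := by
    refine (Real.pow_div_factorial_le_exp _ hs'.le s).trans ?_
    have : Real.exp s = Real.exp 1 ^ s := by rw [← Real.exp_nat_mul, mul_one]
    rw [this]
    exact pow_le_pow_left₀ (Real.exp_nonneg _) (Real.exp_one_lt_d9.le.trans (by norm_num)) s
  have h3 : (k : ℝ) ≤ 2 * d ^ 2 * s := by exact_mod_cast hks
  calc _ ≤ ((n : ℝ) ^ s / s.factorial) * (2 * k / n : ℝ) ^ (2 * s) :=
        mul_le_mul_of_nonneg_right h1 (by positivity)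
    _ = (4 * k ^ 2 / n / s : ℝ) ^ s * ((s : ℝ) ^ s / s.factorial) := by
        have : (4 * k ^ 2 / n / s : ℝ) ^ s * (s : ℝ) ^ s =
            (n : ℝ) ^ s * (2 * k / n : ℝ) ^ (2 * s) := by
          rw [← mul_pow, pow_mul, ← mul_pow]
          congr 1
          field_simp
          ring
        rw [mul_div_assoc', this]
        ring
    _ ≤ (4 * k ^ 2 / n / s : ℝ) ^ s * 3 ^ s := mul_le_mul_of_nonneg_left h2 (by positivity)
    _ = (4 * k ^ 2 / n / s * 3 : ℝ) ^ s := by rw [mul_pow]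
    _ ≤ _ := by
        refine pow_le_pow_left₀ (by positivity) ?_ s
        have h4 : (4 * k ^ 2 / n / s * 3 : ℝ) = 12 * (k / s) * (k / n) := by ring
        rw [h4]
        refine mul_le_mul_of_nonneg_right ?_ (by positivity)
        have : (k : ℝ) / s ≤ 2 * d ^ 2 := by rwa [div_le_iff₀ hs']
        linarith

/-- If `m k ≤ n ^ (1 - γ)` and `k` grows polynomially, a row lies in at most `2 / γ` row sets and
two row sets share a small fraction of their rows, except with small probability. -/
lemma eventually_sparseRegime {m k : ℕ → ℕ} {γ β A : ℝ} (hγ : 0 < γ) (hβ : 0 < β)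
    (hm : ∀ n, 1 ≤ n → 1 ≤ m n) (hk : ∀ n, 1 ≤ n → 1 ≤ k n)
    (hmk : ∀ᶠ n : ℕ in atTop, (m n : ℝ) * k n ≤ (n : ℝ) ^ (-γ) * n)
    (hkA : ∀ᶠ n : ℕ in atTop, (n : ℝ) ^ β ≤ A * k n) (hA : 0 < A) :
    ∃ d : ℕ, ∀ᶠ n : ℕ in atTop, ∃ s, SparseRegime n (k n) (m n) d s := by
  set d : ℕ := ⌈2 / γ⌉₊ with hd
  have hd2 : 2 ≤ γ * (d + 1 : ℕ) := by
    have h := Nat.le_ceil (2 / γ)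
    rw [div_le_iff₀ hγ] at h
    push_cast
    rw [← hd] at h
    nlinarith
  have hd1 : 0 < d := Nat.ceil_pos.2 (by positivity)
  set t : ℕ := ⌈6 / γ⌉₊ + 1 with ht
  have ht6 : 3 ≤ γ / 2 * t := by
    have h := Nat.le_ceil (6 / γ)
    rw [div_le_iff₀ hγ] at h
    rw [ht]
    push_cast
    nlinarith
  refine ⟨d, ?_⟩
  filter_upwards [hmk, hkA, eventually_ge_atTop 1,
    eventually_rpow_neg_le hγ (c := 1 / 2) (by norm_num),
    eventually_rpow_neg_le one_pos (c := 1 / 8 / 2 ^ (d + 1)) (by positivity),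
    eventually_rpow_neg_le (a := γ / 2) (by positivity) (c := 1 / (24 * d ^ 2))
      (by positivity), eventually_le_rpow hβ (A * (d ^ 2 * t : ℕ))]
    with n h1 h2 hn h3 h4 h5 h6
  have hn' : (0 : ℝ) < n := by exact_mod_cast hn
  have hn1 : (1 : ℝ) ≤ n := by exact_mod_cast hn
  have hm1 : (1 : ℝ) ≤ m n := by exact_mod_cast hm n hn
  have hk0 : (0 : ℝ) ≤ k n := Nat.cast_nonneg _
  have hk1 := hk n hn
  have hkt : d ^ 2 * t ≤ k n := by
    have := le_of_mul_le_mul_left (h6.trans h2) hA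
    exact_mod_cast this
  have h4' : (n : ℝ) ^ (-1 : ℝ) ≤ 1 / 8 := h4.trans
    (div_le_self (by norm_num) (one_le_pow₀ (by norm_num)))
  have hmkn : (m n : ℝ) * k n / n ≤ (n : ℝ) ^ (-γ) := by rwa [div_le_iff₀ hn']
  have hkn : (k n : ℝ) / n ≤ (n : ℝ) ^ (-γ) := by
    refine le_trans ?_ hmkn
    gcongr
    nlinarith
  have hmn : (m n : ℝ) ≤ n := by
    have : (1 : ℝ) ≤ k n := by exact_mod_cast hk1
    have h7 : (m n : ℝ) * k n ≤ 1 / 2 * n := h1.trans (mul_le_mul_of_nonneg_right h3 hn'.le)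
    nlinarith
  set s : ℕ := k n / d ^ 2 with hs
  have hd0 : 0 < d ^ 2 := by positivity
  have hts : t ≤ s := (Nat.le_div_iff_mul_le hd0).2 (by rw [mul_comm]; exact hkt)
  have hs0 : 0 < s := lt_of_lt_of_le (by omega) hts
  refine ⟨s, hn, hk1, hm n hn, Nat.mul_div_le _ _, ?_, ?_⟩
  · have h7 : (m n : ℝ) * k n ≤ 1 / 2 * n := h1.trans (mul_le_mul_of_nonneg_right h3 hn'.le)
    have : ((2 * (m n * k n) : ℕ) : ℝ) ≤ n := by
      push_cast
      linarith
    exact_mod_cast this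
  · have e1 : (n : ℝ) * (m n * (2 * k n / n : ℝ)) ^ (d + 1) ≤ 1 / 8 := by
      calc (n : ℝ) * (m n * (2 * k n / n : ℝ)) ^ (d + 1)
          = n * (2 * (m n * k n / n)) ^ (d + 1) := by ring
        _ ≤ n * (2 * (n : ℝ) ^ (-γ)) ^ (d + 1) := by gcongr
        _ = 2 ^ (d + 1) * (n * (n : ℝ) ^ (-γ * (d + 1 : ℕ))) := by
            rw [mul_pow, ← Real.rpow_natCast ((n : ℝ) ^ (-γ)), ← Real.rpow_mul hn'.le]
            ring
        _ ≤ 2 ^ (d + 1) * (n : ℝ) ^ (-1 : ℝ) := by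
            gcongr
            calc (n : ℝ) * (n : ℝ) ^ (-γ * (d + 1 : ℕ)) = (n : ℝ) ^ (1 + -γ * (d + 1 : ℕ)) := by
                  rw [Real.rpow_add hn', Real.rpow_one]
              _ ≤ _ := Real.rpow_le_rpow_of_exponent_le hn1 (by linarith)
        _ ≤ 2 ^ (d + 1) * (1 / 8 / 2 ^ (d + 1)) := by gcongr
        _ = 1 / 8 := by field_simp
    have hks : k n ≤ 2 * d ^ 2 * s := by
      have h8 : k n < d ^ 2 * (s + 1) := by
        rw [mul_comm]
        exact Nat.lt_mul_of_div_lt (Nat.lt_succ_self _) hd0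
      have h9 : d ^ 2 * (s + 1) ≤ d ^ 2 * (2 * s) := Nat.mul_le_mul_left _ (by omega)
      calc k n ≤ d ^ 2 * (2 * s) := h8.le.trans h9
        _ = 2 * d ^ 2 * s := by ring
    have e2 : (m n : ℝ) ^ 2 * (n.choose s * (2 * k n / n : ℝ) ^ (2 * s)) ≤ 1 / 8 := by
      have hbase : (24 * d ^ 2 * (k n / n) : ℝ) ≤ (n : ℝ) ^ (-(γ / 2)) := by
        have hsplit : (n : ℝ) ^ (-γ) = (n : ℝ) ^ (-(γ / 2)) * (n : ℝ) ^ (-(γ / 2)) := by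
          rw [← Real.rpow_add hn']
          congr 1
          ring
        have h10 : (24 * d ^ 2 : ℝ) * (n : ℝ) ^ (-(γ / 2)) ≤ 1 := by
          rw [le_div_iff₀ (by positivity)] at h5
          linarith
        calc (24 * d ^ 2 * (k n / n) : ℝ) ≤ 24 * d ^ 2 * (n : ℝ) ^ (-γ) := by gcongr
          _ = (24 * d ^ 2 * (n : ℝ) ^ (-(γ / 2))) * (n : ℝ) ^ (-(γ / 2)) := by
              rw [hsplit]
              ring
          _ ≤ 1 * (n : ℝ) ^ (-(γ / 2)) := by gcongr
          _ = _ := one_mul _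
      calc _ ≤ (n : ℝ) ^ 2 * ((n : ℝ) ^ (-(γ / 2))) ^ s := by
            refine mul_le_mul (pow_le_pow_left₀ (by positivity) hmn 2)
              ((choose_mul_pow_le hn hs0 hks).trans (pow_le_pow_left₀ (by positivity) hbase s))
              (by positivity) (by positivity)
        _ = (n : ℝ) ^ (2 + -(γ / 2) * s) := by
            rw [← Real.rpow_natCast ((n : ℝ) ^ (-(γ / 2))), ← Real.rpow_mul hn'.le,
              ← Real.rpow_natCast, ← Real.rpow_add hn']
            norm_num
        _ ≤ (n : ℝ) ^ (-1 : ℝ) := by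
            refine Real.rpow_le_rpow_of_exponent_le hn1 ?_
            have : (t : ℝ) ≤ s := by exact_mod_cast hts
            nlinarith
        _ ≤ 1 / 8 := h4'
    linarith

/-- Below the threshold, the low-degree norm is bounded as soon as the degree is subpolynomial
and the multiplicity of words with `r` rows and `c` columns, with the signal of their surplus cells,
is at most `n ^ (η (r + c))` for every `η > 0`. -/
lemma isBigO_lowDegreeNorm {m k : ℕ → ℕ} {lam : ℕ → ℝ}
    (hm : ∀ n, 1 ≤ n → 1 ≤ m n) (hk : ∀ n, 1 ≤ n → 1 ≤ k n) (hlam : ∀ n, 0 < lam n)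
    (h1 : PolyLess (fun n => 1 / Real.sqrt (k n)) lam)
    (h2 : PolyLess lam (fun n => (n : ℝ) / ((m n : ℝ) * (k n : ℝ) ^ 2)))
    {C : ℝ} (hC : 1 ≤ C) (hlamC : ∀ᶠ n in atTop, lam n ≤ C) {D : ℕ → ℕ}
    (hD : ∀ η : ℝ, 0 < η → ∀ᶠ n : ℕ in atTop, (D n : ℝ) ≤ (n : ℝ) ^ η)
    (hfac : ∀ η : ℝ, 0 < η → ∀ᶠ n : ℕ in atTop, ∀ d r c : ℕ, d ≤ D n → 1 ≤ r → r ≤ d → 1 ≤ c →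
      c ≤ d → lam n ^ (2 * (d - max r c)) * (r * c : ℝ) ^ d / d.factorial ≤
        ((n : ℝ) ^ η) ^ (r + c)) :
    (fun n => lowDegreeNorm n (k n) (m n) (lam n) (D n)) =O[atTop] (fun _ => (1 : ℝ)) := by
  obtain ⟨ε₁, hε₁, h1⟩ := h1
  obtain ⟨ε, hε, h2⟩ := h2
  have hthr : ∀ᶠ n : ℕ in atTop, lam n * (m n * (k n : ℝ) ^ 2) ≤ (n : ℝ) ^ (-ε) * n := by
    filter_upwards [h2, eventually_ge_atTop 1] with n h2 hn
    have hm1 : (0 : ℝ) < m n := by exact_mod_cast hm n hn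
    have hk1 : (0 : ℝ) < k n := by exact_mod_cast hk n hn
    rw [mul_div_assoc', le_div_iff₀ (by positivity)] at h2
    exact h2
  have hsqrt : ∀ᶠ n : ℕ in atTop, (n : ℝ) ^ ε₁ ≤ lam n * Real.sqrt (k n) := by
    filter_upwards [h1, eventually_ge_atTop 1] with n h1 hn
    have hk1 : (0 : ℝ) < k n := by exact_mod_cast hk n hn
    have hn' : (0 : ℝ) < n := by exact_mod_cast hn
    rw [div_le_iff₀ (Real.sqrt_pos.2 hk1), Real.rpow_neg hn'.le, mul_assoc, inv_mul_eq_div,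
      le_div_iff₀ (by positivity)] at h1
    linarith
  have hkA : ∀ᶠ n : ℕ in atTop, (n : ℝ) ^ (2 * ε₁) ≤ C ^ 2 * k n := by
    filter_upwards [hsqrt, hlamC] with n h3 h4
    have h5 : (n : ℝ) ^ ε₁ ≤ C * Real.sqrt (k n) :=
      h3.trans (mul_le_mul_of_nonneg_right h4 (Real.sqrt_nonneg _))
    calc (n : ℝ) ^ (2 * ε₁) = ((n : ℝ) ^ ε₁) ^ 2 := by
          rw [mul_comm, Real.rpow_mul (Nat.cast_nonneg n)]
          norm_num
      _ ≤ (C * Real.sqrt (k n)) ^ 2 := pow_le_pow_left₀ (by positivity) h5 2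
      _ = _ := by rw [mul_pow, Real.sq_sqrt (Nat.cast_nonneg _)]
  -- `lam ≥ k ^ (-1 / 2)` turns the threshold into `m k ≤ n ^ (1 - ε)`.
  have hmk : ∀ᶠ n : ℕ in atTop, (m n : ℝ) * k n ≤ (n : ℝ) ^ (-ε) * n := by
    filter_upwards [hsqrt, hthr, eventually_ge_atTop 1] with n h3 h4 hn
    have hn1 : (1 : ℝ) ≤ n := by exact_mod_cast hn
    have hk1 : (1 : ℝ) ≤ k n := by exact_mod_cast hk n hn
    have h5 : 1 ≤ lam n * Real.sqrt (k n) := (Real.one_le_rpow hn1 hε₁.le).trans h3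
    have h6 : Real.sqrt (k n) ≤ k n := Real.sqrt_le_iff.2 ⟨by positivity, by nlinarith⟩
    have h7 : 1 ≤ lam n * k n := h5.trans (mul_le_mul_of_nonneg_left h6 (hlam n).le)
    refine le_trans ?_ h4
    calc (m n : ℝ) * k n = 1 * (m n * k n) := (one_mul _).symm
      _ ≤ (lam n * k n) * (m n * k n) := by gcongr
      _ = _ := by ring
  obtain ⟨d, hreg⟩ := eventually_sparseRegime hε (by positivity : 0 < 2 * ε₁) hm hk hmk hkA
    (by positivity)
  -- The constant is `3` because `‖L^{≤D}‖² ≤ 5`.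
  refine IsBigO.of_bound 3 ?_
  filter_upwards [hreg, hthr, hlamC, hD (ε / 8) (by positivity), hfac (ε / 8) (by positivity),
    eventually_rpow_neg_le (a := 3 * ε / 8) (by positivity) (c := 1 / (64 * C)) (by positivity),
    eventually_ge_atTop 1] with n hreg h3 h4 h5 h6 h7 hn
  obtain ⟨s, hs⟩ := hreg
  have hn' : (0 : ℝ) < n := by exact_mod_cast hn
  have hsmall : 64 * C * (n : ℝ) ^ (-ε) * (D n : ℝ) ^ 4 * (n : ℝ) ^ (ε / 8) ≤ 1 := by
    calc _ ≤ 64 * C * (n : ℝ) ^ (-ε) * ((n : ℝ) ^ (ε / 8)) ^ 4 * (n : ℝ) ^ (ε / 8) := by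
          gcongr
      _ = 64 * C * (n : ℝ) ^ (-(3 * ε / 8)) := by
          rw [← Real.rpow_natCast, ← Real.rpow_mul hn'.le, mul_assoc, mul_assoc,
            ← Real.rpow_add hn', ← Real.rpow_add hn']
          congr 2
          push_cast
          ring
      _ ≤ 64 * C * (1 / (64 * C)) := by gcongr
      _ = 1 := by field_simp
  have h8 := lowDegreeNorm_sq_le hs (hlam n) hC h4 h3 (by positivity) h6 hsmall
  have h9 : 0 ≤ lowDegreeNorm n (k n) (m n) (lam n) (D n) := norm_nonneg _
  rw [Real.norm_of_nonneg h9, norm_one, mul_one]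
  nlinarith

lemma eventually_le_rpow_of_isBigO {D : ℕ → ℕ}
    (hD : ∀ η : ℝ, 0 < η → (fun n : ℕ => (D n : ℝ)) =O[atTop] (fun n : ℕ => (n : ℝ) ^ η))
    {η : ℝ} (hη : 0 < η) : ∀ᶠ n : ℕ in atTop, (D n : ℝ) ≤ (n : ℝ) ^ η := by
  obtain ⟨c, hc⟩ := (hD (η / 2) (by positivity)).bound
  filter_upwards [hc, eventually_le_rpow (a := η / 2) (by positivity) c, eventually_ge_atTop 1]
    with n h1 h2 hn
  have hn' : (0 : ℝ) < n := by exact_mod_cast hn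
  rw [Real.norm_of_nonneg (by positivity), Real.norm_of_nonneg (by positivity)] at h1
  calc (D n : ℝ) ≤ (n : ℝ) ^ (η / 2) * (n : ℝ) ^ (η / 2) := h1.trans (by gcongr)
    _ = (n : ℝ) ^ η := by rw [← Real.rpow_add hn', add_halves]

/-- For polynomially small signal, each of the `d - max r c` surplus cells of a word carries a
factor `lam ^ 2`, which outweighs the at most `D ^ 2` choices for it. -/
lemma word_factor_le_of_polyLess {lam : ℕ → ℝ} (hlam : ∀ n, 0 < lam n)
    (h : PolyLess lam (fun _ => 1)) {D : ℕ → ℕ}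
    (hD : ∀ η : ℝ, 0 < η → ∀ᶠ n : ℕ in atTop, (D n : ℝ) ≤ (n : ℝ) ^ η) {η : ℝ} (hη : 0 < η) :
    ∀ᶠ n : ℕ in atTop, ∀ d r c : ℕ, d ≤ D n → 1 ≤ r → r ≤ d → 1 ≤ c → c ≤ d →
      lam n ^ (2 * (d - max r c)) * (r * c : ℝ) ^ d / d.factorial ≤
        ((n : ℝ) ^ η) ^ (r + c) := by
  obtain ⟨ε, hε, h⟩ := h
  filter_upwards [h, hD ε hε, hD (η / 2) (by positivity), eventually_ge_atTop 1]
    with n h1 h2 h3 hn d r c hd hr1 hrd hc1 hcd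
  have hn' : (0 : ℝ) < n := by exact_mod_cast hn
  have hD1 : (1 : ℝ) ≤ D n := by exact_mod_cast hr1.trans (hrd.trans hd)
  have hl : 0 < lam n := hlam n
  have hlD : lam n * D n ≤ 1 := by
    calc lam n * D n ≤ ((n : ℝ) ^ (-ε) * 1) * (n : ℝ) ^ ε := by gcongr
      _ = 1 := by rw [mul_one, ← Real.rpow_add hn', neg_add_cancel, Real.rpow_zero]
  have hM : max r c ≤ d := max_le hrd hcd
  have hrc : (r * c : ℝ) ≤ (D n : ℝ) ^ 2 := by
    have : r * c ≤ D n ^ 2 := by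
      rw [sq]
      exact Nat.mul_le_mul (hrd.trans hd) (hcd.trans hd)
    exact_mod_cast this
  calc lam n ^ (2 * (d - max r c)) * (r * c : ℝ) ^ d / d.factorial
      ≤ lam n ^ (2 * (d - max r c)) * (r * c : ℝ) ^ d :=
        div_le_self (by positivity) (by exact_mod_cast d.factorial_pos)
    _ ≤ lam n ^ (2 * (d - max r c)) * ((D n : ℝ) ^ 2) ^ d := by gcongr
    _ = (lam n * D n) ^ (2 * (d - max r c)) * (D n : ℝ) ^ (2 * max r c) := by
        have e : ((D n : ℝ) ^ 2) ^ d =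
            (D n : ℝ) ^ (2 * (d - max r c)) * (D n : ℝ) ^ (2 * max r c) := by
          rw [← pow_mul, ← pow_add]
          congr 1
          omega
        rw [e, mul_pow]
        ring
    _ ≤ 1 * (D n : ℝ) ^ (2 * (r + c)) := by
        refine mul_le_mul (pow_le_one₀ (by positivity) hlD) (pow_le_pow_right₀ hD1 ?_)
          (by positivity) zero_le_one
        omega
    _ ≤ 1 * ((n : ℝ) ^ (η / 2)) ^ (2 * (r + c)) := by gcongr
    _ = _ := by
        rw [one_mul, pow_mul]
        congr 1
        rw [← Real.rpow_natCast, ← Real.rpow_mul hn'.le]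
        congr 1
        push_cast
        ring

/-- For bounded signal and logarithmic degree: words with `v = O(log n)` rows and columns are
summed by the exponential series `exp (C ^ 2 v ^ 2)`, and for larger `v` there are at most
`(log n) ^ O(log n)` choices, less than `n ^ (η v)`. -/
lemma word_factor_le_of_log {lam : ℕ → ℝ} (hlam : ∀ n, 0 < lam n) {C : ℝ} (hC : 1 ≤ C)
    (hlamC : ∀ᶠ n in atTop, lam n ≤ C) {D : ℕ → ℕ}
    (hD : (fun n : ℕ => (D n : ℝ)) =O[atTop] (fun n : ℕ => Real.log n)) {η : ℝ} (hη : 0 < η) :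
    ∀ᶠ n : ℕ in atTop, ∀ d r c : ℕ, d ≤ D n → 1 ≤ r → r ≤ d → 1 ≤ c → c ≤ d →
      lam n ^ (2 * (d - max r c)) * (r * c : ℝ) ^ d / d.factorial ≤
        ((n : ℝ) ^ η) ^ (r + c) := by
  obtain ⟨A, hA, hDA⟩ := hD.exists_pos
  have hlog : Tendsto (fun n : ℕ => Real.log n) atTop atTop :=
    Real.tendsto_log_atTop.comp tendsto_natCast_atTop_atTop
  set κ : ℝ := η ^ 2 / (C ^ 2 * A) with hκ
  have hκ0 : 0 < κ := by positivity
  have hexp : ∀ᶠ n : ℕ in atTop,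
      4 * C ^ 2 * (A * Real.log n) ^ 2 ≤ Real.exp (κ * Real.log n) := by
    have h := (isLittleO_pow_exp_pos_mul_atTop 2 hκ0).const_mul_left (4 * C ^ 2 * A ^ 2)
    have h' := hlog.eventually (h.bound one_pos)
    filter_upwards [h'] with n hn
    rw [one_mul, Real.norm_of_nonneg (by positivity), Real.norm_of_nonneg (by positivity)] at hn
    rw [mul_pow, ← mul_assoc]
    exact hn
  filter_upwards [hlamC, hDA.bound, hexp, eventually_ge_atTop 1]
    with n h1 h2 h3 hn d r c hd hr1 hrd hc1 hcd
  have hn' : (0 : ℝ) < n := by exact_mod_cast hn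
  have hl : 0 < lam n := hlam n
  have hL0 : 0 ≤ Real.log n := Real.log_natCast_nonneg n
  rw [Real.norm_of_nonneg (by positivity), Real.norm_of_nonneg hL0] at h2
  have hM : max r c ≤ d := max_le hrd hcd
  have hr0 : (1 : ℝ) ≤ r := by exact_mod_cast hr1
  have hc0 : (1 : ℝ) ≤ c := by exact_mod_cast hc1
  set L : ℝ := Real.log n with hL
  set v : ℝ := r + c with hv
  have hnum : lam n ^ (2 * (d - max r c)) * (r * c : ℝ) ^ d ≤ (C ^ 2 * v ^ 2) ^ d := by
    have e1 : lam n ^ (2 * (d - max r c)) ≤ (C ^ 2) ^ d := by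
      rw [← pow_mul]
      calc lam n ^ (2 * (d - max r c)) ≤ C ^ (2 * (d - max r c)) := by gcongr
        _ ≤ C ^ (2 * d) := pow_le_pow_right₀ hC (by omega)
    have e2 : (r * c : ℝ) ≤ v ^ 2 := by rw [hv]; nlinarith
    rw [mul_pow (C ^ 2)]
    exact mul_le_mul e1 (pow_le_pow_left₀ (by positivity) e2 d) (by positivity) (by positivity)
  have hH : ((n : ℝ) ^ η) ^ (r + c) = Real.exp (η * L * v) := by
    rw [← Real.rpow_natCast, ← Real.rpow_mul hn'.le, Real.rpow_def_of_pos hn']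
    congr 1
    rw [hv]
    push_cast
    ring
  rw [hH]
  -- The exponential series wins while `C ^ 2 * v ≤ η * log n`; `κ` is tuned to the other case.
  rcases le_total (C ^ 2 * v) (η * L) with hsmall | hlarge
  · calc _ ≤ (C ^ 2 * v ^ 2) ^ d / d.factorial := by gcongr
      _ ≤ Real.exp (C ^ 2 * v ^ 2) := Real.pow_div_factorial_le_exp _ (by positivity) d
      _ ≤ _ := by
          refine Real.exp_le_exp.2 ?_
          have : 0 ≤ v := by positivity
          nlinarith
  · have hvD : v ≤ 2 * D n := by
      have : r + c ≤ 2 * D n := by omega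
      rw [hv]
      exact_mod_cast this
    have hv0 : 0 ≤ v := by positivity
    have hbase1 : 1 ≤ C ^ 2 * v ^ 2 := by
      have : 1 ≤ v := by rw [hv]; linarith
      exact one_le_mul_of_one_le_of_one_le (one_le_pow₀ hC) (one_le_pow₀ this)
    have hbase : C ^ 2 * v ^ 2 ≤ Real.exp (κ * L) := by
      refine le_trans ?_ h3
      calc C ^ 2 * v ^ 2 ≤ C ^ 2 * (2 * (A * L)) ^ 2 := by
            gcongr
            linarith
        _ = _ := by ring
    calc _ ≤ lam n ^ (2 * (d - max r c)) * (r * c : ℝ) ^ d :=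
          div_le_self (by positivity) (by exact_mod_cast d.factorial_pos)
      _ ≤ (C ^ 2 * v ^ 2) ^ D n := hnum.trans (pow_le_pow_right₀ hbase1 hd)
      _ ≤ Real.exp (κ * L) ^ D n := by gcongr
      _ = Real.exp (D n * (κ * L)) := by rw [← Real.exp_nat_mul]
      _ ≤ _ := by
          refine Real.exp_le_exp.2 ?_
          have e1 : (D n : ℝ) * (κ * L) ≤ A * L * (κ * L) := by gcongr
          have e2 : A * L * (κ * L) = η * L * (η * L / C ^ 2) := by
            rw [hκ]
            field_simp
          have e3 : η * L / C ^ 2 ≤ v := by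
            rw [div_le_iff₀ (by positivity)]
            linarith
          calc _ ≤ η * L * (η * L / C ^ 2) := e1.trans_eq e2
            _ ≤ η * L * v := by gcongr

end SubmatrixDetection

theorem theorem3 (m k : ℕ → ℕ) (lam : ℕ → ℝ)
    (hm : ∀ n, 1 ≤ n → 1 ≤ m n) (hk : ∀ n, 1 ≤ n → 1 ≤ k n)
    (hmk : ∀ n, 1 ≤ n → m n * k n ≤ n)
    (hlam : ∀ n, 0 < lam n) :
    -- below the threshold
    (SubmatrixDetection.PolyLess (fun n => 1 / Real.sqrt (k n)) lam →
      SubmatrixDetection.PolyLess lam (fun n => (n : ℝ) / ((m n : ℝ) * (k n : ℝ) ^ 2)) →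
      -- bounded signal strength, degree of order `log n`
      (lam =O[atTop] (fun _ => (1 : ℝ)) →
        ∀ D : ℕ → ℕ, (fun n : ℕ => (D n : ℝ)) =Θ[atTop] (fun n : ℕ => Real.log n) →
          (fun n => SubmatrixDetection.lowDegreeNorm n (k n) (m n) (lam n) (D n))
            =O[atTop] (fun _ => (1 : ℝ))) ∧
      -- polynomially small signal strength, every subpolynomial degree that is `Ω(log n)`
      (SubmatrixDetection.PolyLess lam (fun _ => 1) →
        ∀ D : ℕ → ℕ, (fun n : ℕ => Real.log n) =O[atTop] (fun n : ℕ => (D n : ℝ)) →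
          (∀ η : ℝ, 0 < η → (fun n : ℕ => (D n : ℝ)) =O[atTop] (fun n : ℕ => (n : ℝ) ^ η)) →
          (fun n => SubmatrixDetection.lowDegreeNorm n (k n) (m n) (lam n) (D n))
            =O[atTop] (fun _ => (1 : ℝ)))) ∧
    -- above the threshold
    (SubmatrixDetection.PolyLess (fun n => (n : ℝ) / ((m n : ℝ) * (k n : ℝ) ^ 2)) lam →
      ∀ D : ℕ → ℕ, (fun n : ℕ => Real.log n) =O[atTop] (fun n : ℕ => (D n : ℝ)) →
        Tendsto (fun n => SubmatrixDetection.lowDegreeNorm n (k n) (m n) (lam n) (D n))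
          atTop atTop) := by
  refine ⟨fun h1 h2 => ⟨fun hO D hD => ?_, fun hsmall D _ hD => ?_⟩, fun h D hD => ?_⟩
  · obtain ⟨C, hC, hlamC⟩ := hO.exists_pos
    have hlamC' : ∀ᶠ n in atTop, lam n ≤ max C 1 := by
      filter_upwards [hlamC.bound] with n hn
      rw [norm_one, mul_one] at hn
      exact (le_abs_self _).trans (hn.trans (le_max_left _ _))
    have hpoly : ∀ η : ℝ, 0 < η →
        (fun n : ℕ => (D n : ℝ)) =O[atTop] (fun n : ℕ => (n : ℝ) ^ η) := fun η hη =>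
      hD.1.trans ((isLittleO_log_rpow_atTop hη).isBigO.comp_tendsto tendsto_natCast_atTop_atTop)
    exact SubmatrixDetection.isBigO_lowDegreeNorm hm hk hlam h1 h2 (le_max_right C 1) hlamC'
      (fun η hη => SubmatrixDetection.eventually_le_rpow_of_isBigO hpoly hη)
      (fun η hη => SubmatrixDetection.word_factor_le_of_log hlam (le_max_right C 1) hlamC' hD.1 hη)
  · have hlam1 : ∀ᶠ n in atTop, lam n ≤ 1 := by
      obtain ⟨ε, hε, hle⟩ := hsmall
      filter_upwards [hle, SubmatrixDetection.eventually_rpow_neg_le hε one_pos] with n h3 h4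
      linarith
    exact SubmatrixDetection.isBigO_lowDegreeNorm hm hk hlam h1 h2 le_rfl hlam1
      (fun η hη => SubmatrixDetection.eventually_le_rpow_of_isBigO hD hη)
      (fun η hη => SubmatrixDetection.word_factor_le_of_polyLess hlam hsmall
        (fun η hη => SubmatrixDetection.eventually_le_rpow_of_isBigO hD hη) hη)
  · obtain ⟨ε, hε, h⟩ := h
    have hD1 : ∀ᶠ n : ℕ in atTop, 1 ≤ D n := by
      obtain ⟨c, hc⟩ := hD.bound
      have hlog : Tendsto (fun n : ℕ => Real.log n) atTop atTop :=
        Real.tendsto_log_atTop.comp tendsto_natCast_atTop_atTop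
      filter_upwards [hc, hlog.eventually_gt_atTop 0] with n h3 h4
      by_contra hcon
      have : D n = 0 := by omega
      rw [this, Nat.cast_zero, norm_zero, mul_zero, Real.norm_of_nonneg h4.le] at h3
      linarith
    refine tendsto_atTop_mono' atTop ?_
      ((tendsto_rpow_atTop hε).comp tendsto_natCast_atTop_atTop)
    filter_upwards [h, hD1, eventually_ge_atTop 1] with n h3 h4 hn
    refine le_trans ?_ (SubmatrixDetection.le_lowDegreeNorm (hmk n hn) hn (hlam n) h4)
    have hn' : (0 : ℝ) < n := by exact_mod_cast hn
    have hm1 : (0 : ℝ) < m n := by exact_mod_cast hm n hn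
    have hk1 : (0 : ℝ) < k n := by exact_mod_cast hk n hn
    rw [Real.rpow_neg hn'.le, inv_mul_eq_div, div_le_div_iff₀ (by positivity) (by positivity)]
      at h3
    rw [Function.comp_apply, le_div_iff₀ hn']
    linarith
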